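/- Let $k$ be a commutative ring and $A$ a commutative $k$-algebra. For $p\ge 0$ and a non-empty co-ideal $\Delta\subset\mathbb N^p$ (that is, $\alpha\in\Delta$ and $\alpha'\le\alpha$ imply $\alpha'\in\Delta$), let $A[[\mathbf s]]_\Delta$ be the quotient of $A[[s_1,\dots,s_p]]$ by the series with no monomial with exponent in $\Delta$, and let $\mathrm{HS}^p_k(A;\Delta)$ be the group of Hasse–Schmidt derivations, i.e. of families $D=(D_\alpha)_{\alpha\in\Delta}$ of $k$-linear maps $A\to A$ with $D_0=\mathrm{Id}$ and $D_\alpha(xy)=\sum_{\beta+\gamma=\alpha}D_\beta(x)D_\gamma(y)$, with product $(D\circ E)_\alpha=\sum_{\beta+\gamma=\alpha}D_\beta\circ E_\gamma$ and identity element $\mathbb I$. For an integer $m\ge 1$ write $\mathrm{HS}_k(A;m)$ for the case $p=1$, $\Delta=\{0,\dots,m\}$. Let $\mathrm{Ider}^f_k(A)$ be the $A$-module of the f-integrable derivations, i.e. of those $\delta\in\mathrm{Der}_k(A)$ such that for every integer $m\ge 1$ there is $D\in\mathrm{HS}_k(A;m)$ with $D_1=\delta$ (an $m$-integral of $\delta$).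 A substitution map $\varphi:A[[\mathbf s]]_\Delta\to A[[\mathbf t]]_\nabla$ (with $\mathbf s$, $\mathbf t$ of $p$, $q$ variables) is a map of $A$-algebras with each $\varphi(s_i)$ of order $\ge 1$; let $\mathbf C_e(\varphi,\alpha)$ be the coefficient of $\mathbf t^e$ in $\varphi(\mathbf s^\alpha)$, and for $D\in\mathrm{HS}^p_k(A;\Delta)$ let $\varphi\bullet D\in\mathrm{HS}^q_k(A;\nabla)$ be given by $(\varphi\bullet D)_e=\sum_{\alpha\in\Delta,\,|\alpha|\le|e|}\mathbf C_e(\varphi,\alpha)D_\alpha$. The enveloping algebra $\mathbb U_{A/k}$ is the $k$-algebra generated by symbols $\mathbf S_a$ ($a\in A$) and $\mathbf T_{p,\Delta,D,\alpha}$ ($p\ge 0$, $\Delta\subset\mathbb N^p$ a non-empty co-ideal, $D\in\mathrm{HS}^p_k(A;\Delta)$, $\alpha\in\Delta$), subject to the following relations, for all $c\in k$, $a,a'\in A$, all non-empty co-ideals $\Delta\subset\mathbb N^p$, $\nabla\subset\mathbb N^q$, all $D,E\in\mathrm{HS}^p_k(A;\Delta)$, $\alpha\in\Delta$, $\beta\in\nabla$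 and all substitution maps $\varphi:A[[\mathbf s]]_\Delta\to A[[\mathbf t]]_\nabla$: - $\mathbf S_{c1}=c$, $\mathbf S_{a+a'}=\mathbf S_a+\mathbf S_{a'}$, $\mathbf S_{aa'}=\mathbf S_a\mathbf S_{a'}$; - $\mathbf T_{p,\{0\},\mathbb I,0}=1$, and $\mathbf T_{p,\Delta,\mathbb I,\alpha}=0$ if $|\alpha|>0$; - $\mathbf T_{p,\Delta,D\circ E,\alpha}=\sum_{\beta+\gamma=\alpha}\mathbf T_{p,\Delta,D,\beta}\mathbf T_{p,\Delta,E,\gamma}$; - $\mathbf T_{p,\Delta,D,\alpha}\mathbf S_a=\sum_{\beta+\gamma=\alpha}\mathbf S_{D_\beta(a)}\mathbf T_{p,\Delta,D,\gamma}$; - $\mathbf T_{q,\nabla,\varphi\bullet D,\beta}=\sum_{\alpha\in\Delta,\,|\alpha|\le|\beta|}\mathbf S_{\mathbf C_\beta(\varphi,\alpha)}\mathbf T_{p,\Delta,D,\alpha}$. It is filtered: $\mathbb U^d$ is the $k$-span of the monomials in the generators of total degree $\le d$, where $\deg\mathbf S_a=0$ and $\deg\mathbf T_{p,\Delta,D,\alpha}=\lfloor|\alpha|/\ell_\alpha(D)\rfloor$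 with $\ell_\alpha(D)=\min\{r\ge 1:\exists\,\beta\le\alpha,\ |\beta|=r,\ D_\beta\ne 0\}$ (and the degree is $0$ if $\ell_\alpha(D)=\infty$, i.e. if there is no such $r$). Let $\operatorname{gr}\mathbb U_{A/k}=\bigoplus_{d\ge 0}\mathbb U^d/\mathbb U^{d-1}$ (with $\mathbb U^{-1}=0$) and let $\sigma_d:\mathbb U^d\to\operatorname{gr}\mathbb U_{A/k}$ be the symbol maps; $\operatorname{gr}\mathbb U_{A/k}$ receives a ring map from $A$ by $a\mapsto\sigma_0(\mathbf S_a)$. Let $\Gamma_A\mathrm{Ider}^f_k(A)$ be the divided power algebra of the $A$-module $\mathrm{Ider}^f_k(A)$, with divided powers $\gamma_m(\delta)$. There is a unique ring homomorphism over $A$ $$\boldsymbol\vartheta:\Gamma_A\mathrm{Ider}^f_k(A)\longrightarrow\operatorname{gr}\mathbb U_{A/k}$$ such that $\boldsymbol\vartheta(\gamma_m(\delta))=\sigma_m(\mathbf T_{1,\{0,\dots,m\},D,m})$ for every $\delta\in\mathrm{Ider}^f_k(A)$, every integer $m\ge 1$ and every $m$-integral $D\in\mathrm{HS}_k(A;m)$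 of $\delta$. If $\mathrm{Ider}^f_k(A)=\mathrm{Der}_k(A)$, then $\boldsymbol\vartheta$ is surjective. -/

import Mathlib

open scoped DirectSum

noncomputable section

namespace HSEnv

open Finset.HasAntidiagonal (antidiagonal mem_antidiagonal)

universe u v

/-! ### Co-ideals and truncated power series -/

/-- A non-empty co-ideal of `ℕ^p` (the multi-indices are `Fin p →₀ ℕ`, with `|α| = α.degree`). -/
structure Coideal (p : ℕ) where
  /-- the underlying set -/
  carrier : Set (Fin p →₀ ℕ)
  nonempty : carrier.Nonempty
  lower : IsLowerSet carrier

variable {p q : ℕ}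

instance : Membership (Fin p →₀ ℕ) (Coideal p) := ⟨fun Δ α => α ∈ Δ.carrier⟩

theorem Coideal.mem_of_le (Δ : Coideal p) {α β : Fin p →₀ ℕ} (h : β ≤ α) (hα : α ∈ Δ) : β ∈ Δ :=
  Δ.lower h hα

theorem Coideal.zero_mem (Δ : Coideal p) : (0 : Fin p →₀ ℕ) ∈ Δ :=
  Δ.mem_of_le bot_le Δ.nonempty.choose_spec

theorem Coideal.fst_mem (Δ : Coideal p) {α : Fin p →₀ ℕ} (hα : α ∈ Δ)
    {x : (Fin p →₀ ℕ) × (Fin p →₀ ℕ)} (hx : x ∈ antidiagonal α) : x.1 ∈ Δ :=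
  Δ.mem_of_le (by rw [← mem_antidiagonal.1 hx]; exact le_self_add) hα

theorem Coideal.snd_mem (Δ : Coideal p) {α : Fin p →₀ ℕ} (hα : α ∈ Δ)
    {x : (Fin p →₀ ℕ) × (Fin p →₀ ℕ)} (hx : x ∈ antidiagonal α) : x.2 ∈ Δ :=
  Δ.mem_of_le (by rw [← mem_antidiagonal.1 hx]; exact le_add_self) hα

/-- The co-ideal `{0}`. -/
def Coideal.origin (p : ℕ) : Coideal p where
  carrier := {0}
  nonempty := ⟨0, rfl⟩
  lower := by
    intro a b hba ha
    have ha' : a = 0 := ha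
    subst ha'
    exact le_antisymm hba bot_le

/-- The co-ideal `{α : |α| ≤ m}`. -/
def Coideal.tot (p m : ℕ) : Coideal p where
  carrier := {α | α.degree ≤ m}
  nonempty := ⟨0, by simp⟩
  lower := fun _ _ hba ha => le_trans (Finsupp.degree_mono hba) ha

/-- The finite set `{α ∈ Δ : |α| ≤ n}`. -/
def Coideal.upTo (Δ : Coideal p) (n : ℕ) : Finset (Fin p →₀ ℕ) :=
  ((Finsupp.finite_of_degree_le (σ := Fin p) n).inter_of_left {α | α ∈ Δ}).toFinset

theorem Coideal.mem_upTo {Δ : Coideal p} {n : ℕ} {α : Fin p →₀ ℕ} :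
    α ∈ Δ.upTo n ↔ α.degree ≤ n ∧ α ∈ Δ := by
  simp [Coideal.upTo]

/-- The ideal `Δ_A` of the power series whose coefficients with index in `Δ` are zero. -/
def Coideal.ideal (A : Type v) [CommRing A] (Δ : Coideal p) :
    Ideal (MvPowerSeries (Fin p) A) where
  carrier := {f | ∀ α ∈ Δ, MvPowerSeries.coeff α f = 0}
  zero_mem' := fun _ _ => map_zero _
  add_mem' := fun hf hg α hα => by rw [map_add, hf α hα, hg α hα, add_zero]
  smul_mem' := fun c f hf α hα => by
    rw [smul_eq_mul, MvPowerSeries.coeff_mul]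
    exact Finset.sum_eq_zero fun x hx => by
      rw [hf _ (Δ.snd_mem hα hx), mul_zero]

/-- The ring `A[[s]]_Δ = A[[s]] / Δ_A`. -/
abbrev TPS (A : Type v) [CommRing A] (Δ : Coideal p) : Type v :=
  MvPowerSeries (Fin p) A ⧸ Δ.ideal A

section TPS

variable {A : Type v} [CommRing A]

open scoped Classical in
/-- The coefficient of index `e` of an element of `A[[s]]_Δ` (by convention zero if `e ∉ Δ`). -/
def TPS.coeff (Δ : Coideal p) (e : Fin p →₀ ℕ) : TPS A Δ →ₗ[A] A :=
  if he : e ∈ Δ then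
    (Submodule.liftQ ((Δ.ideal A).restrictScalars A) (MvPowerSeries.coeff e)
      fun _ hf => hf e he) ∘ₗ
        (Submodule.Quotient.restrictScalarsEquiv A (Δ.ideal A)).symm.toLinearMap
  else 0

/-- The quotient map `A[[s]] → A[[s]]_Δ`. -/
abbrev TPS.mk (Δ : Coideal p) : MvPowerSeries (Fin p) A →+* TPS A Δ :=
  Ideal.Quotient.mk (Δ.ideal A)

theorem TPS.coeff_mk {Δ : Coideal p} {e : Fin p →₀ ℕ} (he : e ∈ Δ)
    (f : MvPowerSeries (Fin p) A) :
    TPS.coeff Δ e (TPS.mk Δ f) = MvPowerSeries.coeff e f := by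
  rw [TPS.coeff, dif_pos he]
  rfl

theorem TPS.coeff_of_notMem {Δ : Coideal p} {e : Fin p →₀ ℕ} (he : e ∉ Δ) (f : TPS A Δ) :
    TPS.coeff Δ e f = 0 := by
  rw [TPS.coeff, dif_neg he]
  rfl

theorem TPS.ext {Δ : Coideal p} {f g : TPS A Δ}
    (h : ∀ e ∈ Δ, TPS.coeff Δ e f = TPS.coeff Δ e g) : f = g := by
  obtain ⟨f, rfl⟩ := Ideal.Quotient.mk_surjective f
  obtain ⟨g, rfl⟩ := Ideal.Quotient.mk_surjective g
  refine Ideal.Quotient.eq.2 fun e he => ?_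
  have := h e he
  rw [TPS.coeff_mk he, TPS.coeff_mk he] at this
  rw [map_sub, this, sub_self]

theorem TPS.coeff_mul {Δ : Coideal p} {e : Fin p →₀ ℕ} (he : e ∈ Δ) (f g : TPS A Δ) :
    TPS.coeff Δ e (f * g) =
      ∑ x ∈ antidiagonal e, TPS.coeff Δ x.1 f * TPS.coeff Δ x.2 g := by
  obtain ⟨f, rfl⟩ := Ideal.Quotient.mk_surjective f
  obtain ⟨g, rfl⟩ := Ideal.Quotient.mk_surjective g
  rw [← map_mul, TPS.coeff_mk he, MvPowerSeries.coeff_mul]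
  exact Finset.sum_congr rfl fun x hx => by
    rw [TPS.coeff_mk (Δ.fst_mem he hx), TPS.coeff_mk (Δ.snd_mem he hx)]

end TPS

/-- A substitution map `A[[s]]_Δ → A[[t]]_∇`: a map of `A`-algebras that sends each variable to
a series of order at least `1`. -/
structure SubstMap (A : Type v) [CommRing A] (Δ : Coideal p) (Nb : Coideal q) where
  /-- the underlying map of `A`-algebras -/
  toAlgHom : TPS A Δ →ₐ[A] TPS A Nb
  order_pos : ∀ i : Fin p, TPS.coeff Nb 0 (toAlgHom (TPS.mk Δ (MvPowerSeries.X i))) = 0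

/-- The coefficient `C_e(φ, α)` of `t^e` in `φ(s^α)`. -/
def SubstMap.C {A : Type v} [CommRing A] {Δ : Coideal p} {Nb : Coideal q} (φ : SubstMap A Δ Nb)
    (e : Fin q →₀ ℕ) (α : Fin p →₀ ℕ) : A :=
  TPS.coeff Nb e (φ.toAlgHom (TPS.mk Δ (MvPowerSeries.monomial α 1)))

/-! ### Hasse--Schmidt derivations -/

section HS

variable (k : Type u) (A : Type v) [CommRing k] [CommRing A] [Algebra k A]

/-- A `(p, Δ)`-variate Hasse--Schmidt derivation of `A` over `k`, that is a family
`(D_α)_{α ∈ Δ}` of `k`-linear maps. The family is extended by zero to the indices outside `Δ`;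
these values carry no information. -/
@[ext]
structure HS (Δ : Coideal p) where
  /-- the components `D_α` -/
  coeff : (Fin p →₀ ℕ) → (A →ₗ[k] A)
  coeff_notMem : ∀ α, α ∉ Δ → coeff α = 0
  coeff_zero : coeff 0 = LinearMap.id
  leibniz : ∀ α ∈ Δ, ∀ x y : A,
    coeff α (x * y) = ∑ b ∈ antidiagonal α, coeff b.1 x * coeff b.2 y

variable {k A}

open scoped Classical in
/-- The identity Hasse--Schmidt derivation `𝕀`. -/
def HS.one (Δ : Coideal p) : HS k A Δ where
  coeff α := if α = 0 then LinearMap.id else 0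
  coeff_notMem α hα := if_neg fun h => hα (by rw [h]; exact Δ.zero_mem)
  coeff_zero := if_pos rfl
  leibniz α _ x y := by
    by_cases h : α = 0
    · subst h
      simp
    · rw [if_neg h]
      refine (Finset.sum_eq_zero fun b hb => ?_).symm
      by_cases h1 : b.1 = 0
      · have h2 : b.2 ≠ 0 := fun h2 => h (by
          rw [← mem_antidiagonal.1 hb, h1, h2, add_zero])
        rw [if_neg h2, LinearMap.zero_apply, mul_zero]
      · rw [if_neg h1, LinearMap.zero_apply, zero_mul]

theorem sum_antidiagonal_swap {M : Type*} [AddCommMonoid M] (α : Fin p →₀ ℕ)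
    (f : (Fin p →₀ ℕ) → (Fin p →₀ ℕ) → (Fin p →₀ ℕ) → (Fin p →₀ ℕ) → M) :
    ∑ x ∈ antidiagonal α, ∑ z ∈ antidiagonal x.2, ∑ y ∈ antidiagonal x.1,
        f y.1 y.2 z.1 z.2 =
      ∑ x ∈ antidiagonal α, ∑ y ∈ antidiagonal x.1,
        ∑ z ∈ antidiagonal x.2, f y.1 z.1 y.2 z.2 := by
  simp_rw [Finset.sum_sigma']
  refine Finset.sum_nbij'
    (fun w => ⟨(w.2.2.1 + w.2.1.1, w.2.2.2 + w.2.1.2), (w.2.2.1, w.2.1.1), (w.2.2.2, w.2.1.2)⟩)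
    (fun w => ⟨(w.2.1.1 + w.2.2.1, w.2.1.2 + w.2.2.2), (w.2.1.2, w.2.2.2), (w.2.1.1, w.2.2.1)⟩)
    ?_ ?_ ?_ ?_ ?_
  · rintro ⟨⟨a, b⟩, ⟨c, d⟩, ⟨e, g⟩⟩ hw
    simp only [Finset.mem_sigma, mem_antidiagonal] at hw ⊢
    obtain ⟨rfl, rfl, rfl⟩ := hw
    simp only [and_true]
    abel
  · rintro ⟨⟨a, b⟩, ⟨c, d⟩, ⟨e, g⟩⟩ hw
    simp only [Finset.mem_sigma, mem_antidiagonal] at hw ⊢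
    obtain ⟨rfl, rfl, rfl⟩ := hw
    simp only [and_true]
    abel
  · rintro ⟨⟨a, b⟩, ⟨c, d⟩, ⟨e, g⟩⟩ hw
    simp only [Finset.mem_sigma, mem_antidiagonal] at hw ⊢
    obtain ⟨rfl, rfl, rfl⟩ := hw
    rfl
  · rintro ⟨⟨a, b⟩, ⟨c, d⟩, ⟨e, g⟩⟩ hw
    simp only [Finset.mem_sigma, mem_antidiagonal] at hw ⊢
    obtain ⟨rfl, rfl, rfl⟩ := hw
    rfl
  · intro w _
    rfl

open scoped Classical in
/-- The group law of Hasse--Schmidt derivations, `(D ∘ E)_α = ∑_{β+γ=α} D_β ∘ E_γ`. -/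
def HS.comp {Δ : Coideal p} (D E : HS k A Δ) : HS k A Δ where
  coeff α :=
    if α ∈ Δ then ∑ x ∈ antidiagonal α, D.coeff x.1 ∘ₗ E.coeff x.2 else 0
  coeff_notMem α hα := if_neg hα
  coeff_zero := by
    rw [if_pos Δ.zero_mem]
    simp [D.coeff_zero, E.coeff_zero]
  leibniz α hα x y := by
    rw [if_pos hα]
    have h1 : ∀ b ∈ antidiagonal α,
        (if b.1 ∈ Δ then ∑ z ∈ antidiagonal b.1, D.coeff z.1 ∘ₗ E.coeff z.2 else 0) x *
          (if b.2 ∈ Δ then ∑ z ∈ antidiagonal b.2, D.coeff z.1 ∘ₗ E.coeff z.2 else 0) y =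
        ∑ z ∈ antidiagonal b.1, ∑ w ∈ antidiagonal b.2,
          D.coeff z.1 (E.coeff z.2 x) * D.coeff w.1 (E.coeff w.2 y) := by
      intro b hb
      rw [if_pos (Δ.fst_mem hα hb), if_pos (Δ.snd_mem hα hb), LinearMap.sum_apply,
        LinearMap.sum_apply, Finset.sum_mul_sum]
      rfl
    rw [Finset.sum_congr rfl h1, LinearMap.sum_apply]
    rw [← sum_antidiagonal_swap α
      (fun a b c d => D.coeff a (E.coeff c x) * D.coeff b (E.coeff d y))]
    refine Finset.sum_congr rfl fun b hb => ?_
    rw [LinearMap.comp_apply, E.leibniz _ (Δ.snd_mem hα hb), map_sum]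
    exact Finset.sum_congr rfl fun c _ => D.leibniz _ (Δ.fst_mem hα hb) _ _

/-- The power series `∑_α D_α(a) s^α`. -/
def HS.series {Δ : Coideal p} (D : HS k A Δ) (a : A) : MvPowerSeries (Fin p) A :=
  fun α => D.coeff α a

theorem HS.coeff_series {Δ : Coideal p} (D : HS k A Δ) (a : A) (e : Fin p →₀ ℕ) :
    MvPowerSeries.coeff e (D.series a) = D.coeff e a :=
  rfl

theorem HS.coeff_one {Δ : Coideal p} (D : HS k A Δ) :
    ∀ e ∈ Δ, e ≠ 0 → D.coeff e 1 = 0 := by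
  intro e
  induction hn : e.degree using Nat.strong_induction_on generalizing e with
  | _ n ih =>
    intro he h0
    have hl := D.leibniz e he 1 1
    rw [mul_one] at hl
    have hsub : ({(0, e), (e, 0)} : Finset _) ⊆ antidiagonal e := by
      intro x hx
      rcases Finset.mem_insert.1 hx with rfl | hx
      · simp
      · rw [Finset.mem_singleton.1 hx]; simp
    rw [← Finset.sum_subset hsub, Finset.sum_pair (by simp [Ne.symm h0]), D.coeff_zero] at hl
    · simpa using hl
    · intro x hx hx'
      have hxe := mem_antidiagonal.1 hx
      have hd : x.1.degree + x.2.degree = n := by rw [← hn, ← hxe, map_add]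
      have h1 : x.1 ≠ 0 := fun h => hx' (by
        rw [h, zero_add] at hxe
        simp [Prod.ext_iff, h, hxe])
      have h2 : x.2 ≠ 0 := fun h => hx' (by
        rw [h, add_zero] at hxe
        simp [Prod.ext_iff, h, hxe])
      have hp : 0 < x.2.degree := Nat.pos_of_ne_zero fun h =>
        h2 ((Finsupp.degree_eq_zero_iff _).1 h)
      rw [ih x.1.degree (by omega) x.1 rfl (Δ.fst_mem he hx) h1, zero_mul]

/-- The map of `k`-algebras `Φ_D : A → A[[s]]_Δ`, `a ↦ ∑_{α ∈ Δ} D_α(a) s^α`. -/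
def HS.Phi {Δ : Coideal p} (D : HS k A Δ) : A →ₐ[k] TPS A Δ :=
  AlgHom.ofLinearMap
    { toFun := fun a => TPS.mk Δ (D.series a)
      map_add' := fun a b => TPS.ext fun e he => by
        rw [map_add, TPS.coeff_mk he, TPS.coeff_mk he, TPS.coeff_mk he, D.coeff_series,
          D.coeff_series, D.coeff_series, map_add]
      map_smul' := fun c a => TPS.ext fun e he => by
        rw [RingHom.id_apply, ← algebraMap_smul A c (TPS.mk Δ (D.series a)), map_smul,
          TPS.coeff_mk he, TPS.coeff_mk he, algebraMap_smul, D.coeff_series, D.coeff_series,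
          map_smul] }
    (TPS.ext fun e he => by
      rw [← map_one (Ideal.Quotient.mk (Δ.ideal A))]
      change TPS.coeff Δ e (TPS.mk Δ (D.series 1)) = TPS.coeff Δ e (TPS.mk Δ 1)
      rw [TPS.coeff_mk he, TPS.coeff_mk he, MvPowerSeries.coeff_one, D.coeff_series]
      split_ifs with h
      · rw [h, D.coeff_zero]; rfl
      · exact D.coeff_one e he h)
    (fun a b => TPS.ext fun e he => by
      rw [TPS.coeff_mul he]
      change TPS.coeff Δ e (TPS.mk Δ (D.series (a * b))) =
        ∑ x ∈ _, TPS.coeff Δ _ (TPS.mk Δ (D.series a)) * TPS.coeff Δ _ (TPS.mk Δ (D.series b))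
      rw [TPS.coeff_mk he, D.coeff_series]
      refine (D.leibniz e he a b).trans (Finset.sum_congr rfl fun x hx => ?_)
      rw [TPS.coeff_mk (Δ.fst_mem he hx), TPS.coeff_mk (Δ.snd_mem he hx), D.coeff_series,
        D.coeff_series])

theorem HS.coeff_Phi {Δ : Coideal p} (D : HS k A Δ) {e : Fin p →₀ ℕ} (he : e ∈ Δ) (a : A) :
    TPS.coeff Δ e (D.Phi a) = D.coeff e a :=
  TPS.coeff_mk he _

end HS

/-! ### The action of substitution maps -/

section Action

variable {A : Type v} [CommRing A]

theorem TPS.coeff_eq_zero_of_order {Nb : Coideal q} {f g : TPS A Nb} {m n : ℕ}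
    (hf : ∀ e, e.degree < m → TPS.coeff Nb e f = 0)
    (hg : ∀ e, e.degree < n → TPS.coeff Nb e g = 0) (e : Fin q →₀ ℕ) (he : e.degree < m + n) :
    TPS.coeff Nb e (f * g) = 0 := by
  by_cases h : e ∈ Nb
  · rw [TPS.coeff_mul h]
    refine Finset.sum_eq_zero fun x hx => ?_
    have hd : x.1.degree + x.2.degree = e.degree := by rw [← mem_antidiagonal.1 hx, map_add]
    by_cases h1 : x.1.degree < m
    · rw [hf _ h1, zero_mul]
    · rw [hg x.2 (by omega), mul_zero]
  · exact TPS.coeff_of_notMem h _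

theorem exists_eq_sum_X_mul {n : ℕ} (f : MvPowerSeries (Fin p) A)
    (hf : ∀ α : Fin p →₀ ℕ, α.degree < n + 1 → MvPowerSeries.coeff α f = 0) :
    ∃ g : Fin p → MvPowerSeries (Fin p) A,
      (∀ i, ∀ α : Fin p →₀ ℕ, α.degree < n → MvPowerSeries.coeff α (g i) = 0) ∧
        f = ∑ i, MvPowerSeries.X i * g i := by
  classical
  have hch : ∀ α : Fin p →₀ ℕ, α ≠ 0 → ∃ i, α i ≠ 0 := fun α h => by
    by_contra! h'
    exact h (Finsupp.ext h')
  rcases isEmpty_or_nonempty (Fin p) with hp | hp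
  · refine ⟨fun _ => 0, fun i => hp.elim i, ?_⟩
    ext α
    have h0 : α = 0 := Finsupp.ext fun i => hp.elim i
    rw [hf α (by rw [h0, map_zero]; omega)]
    simp
  choose! c hc using hch
  obtain ⟨g, hg⟩ : ∃ g : Fin p → MvPowerSeries (Fin p) A, ∀ i α, MvPowerSeries.coeff α (g i) =
      if c (α + Finsupp.single i 1) = i then
        MvPowerSeries.coeff (α + Finsupp.single i 1) f else 0 :=
    ⟨fun i => fun α => if c (α + Finsupp.single i 1) = i then
      MvPowerSeries.coeff (α + Finsupp.single i 1) f else 0, fun _ _ => rfl⟩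
  refine ⟨g, ?_, ?_⟩
  · intro i α hα
    rw [hg, hf _ (by rw [map_add, Finsupp.degree_single]; omega), ite_self]
  · ext α
    rw [map_sum]
    have hterm : ∀ i : Fin p, ∀ g : MvPowerSeries (Fin p) A,
        MvPowerSeries.coeff α (MvPowerSeries.X i * g) =
          if Finsupp.single i 1 ≤ α then MvPowerSeries.coeff (α - Finsupp.single i 1) g else 0 := by
      intro i g
      rw [MvPowerSeries.X, MvPowerSeries.coeff_monomial_mul, one_mul]
    by_cases h0 : α = 0
    · rw [hf α (by rw [h0, map_zero]; omega)]
      refine (Finset.sum_eq_zero fun i _ => ?_).symm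
      rw [hterm, if_neg]
      intro h
      have := h i
      rw [h0] at this
      simp at this
    · rw [Finset.sum_eq_single (c α)]
      · have hle : Finsupp.single (c α) 1 ≤ α :=
          Finsupp.single_le_iff.2 (Nat.one_le_iff_ne_zero.2 (hc α h0))
        rw [hterm, if_pos hle, hg, tsub_add_cancel_of_le hle, if_pos rfl]
      · intro i _ hi
        rw [hterm]
        split_ifs with hle
        · rw [hg, tsub_add_cancel_of_le hle, if_neg (Ne.symm hi)]
        · rfl
      · intro h
        exact absurd (Finset.mem_univ _) h

theorem SubstMap.order_map {Δ : Coideal p} {Nb : Coideal q} (φ : SubstMap A Δ Nb) (n : ℕ) :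
    ∀ f : MvPowerSeries (Fin p) A,
      (∀ α : Fin p →₀ ℕ, α.degree < n → MvPowerSeries.coeff α f = 0) →
      ∀ e : Fin q →₀ ℕ, e.degree < n → TPS.coeff Nb e (φ.toAlgHom (TPS.mk Δ f)) = 0 := by
  induction n with
  | zero => intro f _ e he; omega
  | succ n ih =>
    intro f hf e he
    obtain ⟨g, hg, rfl⟩ := exists_eq_sum_X_mul f hf
    rw [map_sum, map_sum, map_sum]
    refine Finset.sum_eq_zero fun i _ => ?_
    rw [map_mul, map_mul]
    refine TPS.coeff_eq_zero_of_order (m := 1) (n := n) ?_ (ih _ (hg i)) e (by omega)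
    intro e' he'
    rw [(Finsupp.degree_eq_zero_iff e').1 (by omega)]
    exact φ.order_pos i

/-- `φ(∑ a_α s^α) = ∑_e (∑_{|α| ≤ |e|} C_e(φ, α) a_α) t^e`. -/
theorem SubstMap.coeff_map {Δ : Coideal p} {Nb : Coideal q} (φ : SubstMap A Δ Nb)
    (e : Fin q →₀ ℕ) (f : TPS A Δ) :
    TPS.coeff Nb e (φ.toAlgHom f) =
      ∑ α ∈ Δ.upTo e.degree, φ.C e α * TPS.coeff Δ α f := by
  classical
  set P : MvPowerSeries (Fin p) A :=
    ∑ α ∈ Δ.upTo e.degree, MvPowerSeries.monomial α (TPS.coeff Δ α f) with hP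
  set F : MvPowerSeries (Fin p) A := fun α => TPS.coeff Δ α f with hF
  have hFc : ∀ α, MvPowerSeries.coeff α F = TPS.coeff Δ α f := fun α => rfl
  have hfF : f = TPS.mk Δ F := TPS.ext fun α hα => by rw [TPS.coeff_mk hα, hFc]
  have hPc : ∀ α, MvPowerSeries.coeff α P =
      if α ∈ Δ.upTo e.degree then TPS.coeff Δ α f else 0 := by
    intro α
    rw [hP, map_sum]
    simp_rw [MvPowerSeries.coeff_monomial]
    rw [Finset.sum_ite_eq]
  have hzero : TPS.coeff Nb e (φ.toAlgHom (TPS.mk Δ (F - P))) = 0 := by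
    refine φ.order_map (e.degree + 1) _ ?_ e (Nat.lt_succ_self _)
    intro α hα
    rw [map_sub, hFc, hPc]
    split_ifs with h
    · exact sub_self _
    · rw [sub_zero]
      refine TPS.coeff_of_notMem (fun h' => h ?_) f
      exact Coideal.mem_upTo.2 ⟨by omega, h'⟩
  have hsplit : f = TPS.mk Δ (F - P) + TPS.mk Δ P := by
    rw [← map_add, sub_add_cancel]
    exact hfF
  have hmono : ∀ (α : Fin p →₀ ℕ) (a : A),
      TPS.mk Δ (MvPowerSeries.monomial α a) = a • TPS.mk Δ (MvPowerSeries.monomial α 1) := by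
    intro α a
    have : MvPowerSeries.monomial α a = a • (MvPowerSeries.monomial α (1 : A)) := by
      rw [← map_smul, smul_eq_mul, mul_one]
    rw [this]
    rfl
  conv_lhs => rw [hsplit]
  rw [map_add, map_add, hzero, zero_add, hP, map_sum, map_sum, map_sum]
  refine Finset.sum_congr rfl fun α _ => ?_
  rw [hmono, map_smul, map_smul, smul_eq_mul, mul_comm]
  rfl

variable {k : Type u} [CommRing k] [Algebra k A]

/-- The action `φ • D` of a substitution map on a Hasse--Schmidt derivation:
`(φ • D)_e = ∑_{α ∈ Δ, |α| ≤ |e|} C_e(φ, α) D_α` for `e ∈ ∇`. -/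
def HS.bullet {Δ : Coideal p} {Nb : Coideal q} (φ : SubstMap A Δ Nb) (D : HS k A Δ) :
    HS k A Nb where
  coeff e := ∑ α ∈ Δ.upTo e.degree, φ.C e α • D.coeff α
  coeff_notMem e he := by
    refine Finset.sum_eq_zero fun α _ => ?_
    rw [SubstMap.C, TPS.coeff_of_notMem he, zero_smul]
  coeff_zero := by
    have h : Δ.upTo (0 : Fin q →₀ ℕ).degree = {0} := by
      ext α
      rw [Coideal.mem_upTo, Finset.mem_singleton, map_zero]
      constructor
      · rintro ⟨h, _⟩
        exact (Finsupp.degree_eq_zero_iff α).1 (by omega)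
      · rintro rfl
        exact ⟨by rw [map_zero], Δ.zero_mem⟩
    have h1 : φ.C 0 0 = 1 := by
      have : TPS.mk Δ (MvPowerSeries.monomial (0 : Fin p →₀ ℕ) (1 : A)) = 1 := map_one _
      rw [SubstMap.C, this, map_one, ← map_one (Ideal.Quotient.mk (Nb.ideal A))]
      exact (TPS.coeff_mk Nb.zero_mem 1).trans (by simp)
    rw [h, Finset.sum_singleton, h1, one_smul, D.coeff_zero]
  leibniz := by
    have key : ∀ (e : Fin q →₀ ℕ) (a : A),
        (∑ α ∈ Δ.upTo e.degree, φ.C e α • D.coeff α) a =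
          TPS.coeff Nb e (φ.toAlgHom (D.Phi a)) := by
      intro e a
      rw [φ.coeff_map, LinearMap.sum_apply]
      refine Finset.sum_congr rfl fun α hα => ?_
      rw [D.coeff_Phi (Coideal.mem_upTo.1 hα).2]
      rfl
    intro e he x y
    rw [key, map_mul, map_mul, TPS.coeff_mul he]
    exact Finset.sum_congr rfl fun b _ => by rw [key, key]

/-- The defining property `Φ_{φ • D} = φ ∘ Φ_D`. -/
theorem HS.Phi_bullet {Δ : Coideal p} {Nb : Coideal q} (φ : SubstMap A Δ Nb) (D : HS k A Δ)
    (a : A) : (D.bullet φ).Phi a = φ.toAlgHom (D.Phi a) :=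
  TPS.ext fun e he => by
    rw [HS.coeff_Phi _ he, φ.coeff_map]
    change (∑ α ∈ Δ.upTo e.degree, φ.C e α • D.coeff α) a = _
    rw [LinearMap.sum_apply]
    refine Finset.sum_congr rfl fun α hα => ?_
    rw [D.coeff_Phi (Coideal.mem_upTo.1 hα).2]
    rfl

end Action

/-! ### Integrable derivations -/

section Integrable

variable (k : Type u) (A : Type v) [CommRing k] [CommRing A] [Algebra k A]

/-- The multi-index `j` in one variable. -/
abbrev idx (j : ℕ) : Fin 1 →₀ ℕ := Finsupp.single 0 j

theorem idx_mem_tot {j m : ℕ} (h : j ≤ m) : idx j ∈ Coideal.tot 1 m := by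
  change (idx j).degree ≤ m
  rw [Finsupp.degree_single]
  exact h

variable {k A} in
/-- `a • D`, with components `a^j D_j`, for a Hasse--Schmidt derivation in one variable. -/
def HS.scale {Δ : Coideal 1} (a : A) (D : HS k A Δ) : HS k A Δ where
  coeff α := a ^ α.degree • D.coeff α
  coeff_notMem α hα := by rw [D.coeff_notMem α hα, smul_zero]
  coeff_zero := by rw [map_zero, pow_zero, one_smul, D.coeff_zero]
  leibniz α hα x y := by
    rw [LinearMap.smul_apply, D.leibniz α hα, Finset.smul_sum]
    refine Finset.sum_congr rfl fun b hb => ?_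
    rw [← mem_antidiagonal.1 hb, map_add, pow_add, LinearMap.smul_apply, LinearMap.smul_apply,
      smul_mul_smul_comm]

/-- `Ider_k(A; m)` for an integer `m ≥ 1`: the `A`-module of the `k`-derivations `δ` of `A` for
which there is `D ∈ HS_k(A; m)` with `D_1 = δ`. -/
def Ider (m : ℕ) (hm : 1 ≤ m) : Submodule A (Derivation k A A) where
  carrier := {δ | ∃ D : HS k A (Coideal.tot 1 m), D.coeff (idx 1) = δ.toLinearMap}
  zero_mem' := ⟨HS.one _, if_neg (by simp)⟩
  add_mem' := by
    classical
    rintro δ ε ⟨D, hD⟩ ⟨E, hE⟩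
    refine ⟨D.comp E, ?_⟩
    change (if idx 1 ∈ Coideal.tot 1 m then
      ∑ x ∈ antidiagonal (idx 1), D.coeff x.1 ∘ₗ E.coeff x.2 else 0) = _
    have h : antidiagonal (idx 1) = {(0, idx 1), (idx 1, 0)} := by
      rw [Finsupp.antidiagonal_single]
      simp [Finset.Nat.antidiagonal_succ]
    rw [if_pos (idx_mem_tot hm), h, Finset.sum_pair (by simp), D.coeff_zero, E.coeff_zero, hD, hE]
    ext x
    exact add_comm _ _
  smul_mem' := by
    rintro a δ ⟨D, hD⟩
    refine ⟨D.scale a, ?_⟩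
    change a ^ (idx 1).degree • D.coeff (idx 1) = _
    rw [Finsupp.degree_single, pow_one, hD]
    rfl

/-- The `A`-module `Ider^f_k(A)` of the f-integrable `k`-derivations of `A`. -/
def IderF : Submodule A (Derivation k A A) :=
  ⨅ (m : ℕ) (hm : 1 ≤ m), Ider k A m hm

end Integrable

/-! ### The associated graded ring of a filtered algebra -/

/-- An increasing filtration, indexed by `ℕ`, of a `k`-algebra `R`. -/
structure AlgFiltration (k : Type*) (R : Type*) [CommRing k] [Ring R] [Algebra k R] where
  /-- the terms of the filtration -/
  F : ℕ → Submodule k R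
  mono : Monotone F
  one_mem : (1 : R) ∈ F 0
  mul_mem : ∀ {i j : ℕ} {x y : R}, x ∈ F i → y ∈ F j → x * y ∈ F (i + j)

namespace AlgFiltration

variable {k : Type*} {R : Type*} [CommRing k] [Ring R] [Algebra k R] (W : AlgFiltration k R)

/-- The term of index `d - 1` of the filtration (zero if `d = 0`). -/
def lt : ℕ → Submodule k R
  | 0 => ⊥
  | d + 1 => W.F d

/-- The graded piece `F_d / F_{d-1}`. -/
abbrev piece (d : ℕ) : Type _ := W.F d ⧸ (W.lt d).comap (W.F d).subtype

/-- The class in `F_d / F_{d-1}`. -/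
abbrev cls (d : ℕ) (x : W.F d) : W.piece d := ((W.lt d).comap (W.F d).subtype).mkQ x

theorem mul_lt {i j : ℕ} {x y : R} (hx : x ∈ W.F i) (hy : y ∈ W.lt j) :
    x * y ∈ W.lt (i + j) := by
  cases j with
  | zero =>
    rw [(Submodule.mem_bot k).1 hy, mul_zero]
    exact zero_mem _
  | succ j => exact W.mul_mem hx hy

theorem lt_mul {i j : ℕ} {x y : R} (hx : x ∈ W.lt i) (hy : y ∈ W.F j) :
    x * y ∈ W.lt (i + j) := by
  cases i with
  | zero =>
    rw [(Submodule.mem_bot k).1 hx, zero_mul]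
    exact zero_mem _
  | succ i =>
    rw [Nat.succ_add_eq_add_succ i j]
    exact W.mul_mem hx hy

/-- The product of graded pieces, on representatives. -/
def preMul (i j : ℕ) : W.F i →ₗ[k] W.F j →ₗ[k] W.piece (i + j) :=
  LinearMap.mk₂ k (fun x y => W.cls (i + j) ⟨x.1 * y.1, W.mul_mem x.2 y.2⟩)
    (fun x x' y => by rw [← map_add]; congr 1; ext; exact add_mul _ _ _)
    (fun c x y => by rw [← map_smul]; congr 1; ext; exact smul_mul_assoc _ _ _)
    (fun x y y' => by rw [← map_add]; congr 1; ext; exact mul_add _ _ _)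
    (fun c x y => by rw [← map_smul]; congr 1; ext; exact mul_smul_comm _ _ _)

theorem cls_eq_zero {d : ℕ} {x : W.F d} (hx : x.1 ∈ W.lt d) : W.cls d x = 0 :=
  (Submodule.Quotient.mk_eq_zero _).2 hx

/-- The product of graded pieces. -/
def mulPiece (i j : ℕ) : W.piece i →ₗ[k] W.piece j →ₗ[k] W.piece (i + j) :=
  Submodule.liftQ _
    (Submodule.liftQ ((W.lt j).comap (W.F j).subtype) (W.preMul i j).flip
      (fun _ hy => LinearMap.ext fun x => W.cls_eq_zero (W.mul_lt x.2 hy))).flip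
    (fun _ hx => LinearMap.ext fun y => by
      obtain ⟨y, rfl⟩ := Submodule.mkQ_surjective _ y
      exact W.cls_eq_zero (W.lt_mul hx y.2))

theorem mulPiece_cls {i j : ℕ} (x : W.F i) (y : W.F j) :
    W.mulPiece i j (W.cls i x) (W.cls j y) = W.cls (i + j) ⟨x.1 * y.1, W.mul_mem x.2 y.2⟩ :=
  rfl

theorem mk_cls_eq {i j : ℕ} (h : i = j) (x : W.F i) (y : W.F j) (hxy : x.1 = y.1) :
    (GradedMonoid.mk i (W.cls i x) : GradedMonoid W.piece) = GradedMonoid.mk j (W.cls j y) := by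
  subst h
  rw [Subtype.ext hxy]

theorem natCast_mem (n : ℕ) : (n : R) ∈ W.F 0 := by
  rw [← nsmul_one]
  exact nsmul_mem W.one_mem n

theorem intCast_mem (n : ℤ) : (n : R) ∈ W.F 0 := by
  rw [← zsmul_one]
  exact zsmul_mem W.one_mem n

instance gmul : GradedMonoid.GMul W.piece where
  mul {i j} x y := W.mulPiece i j x y

instance gone : GradedMonoid.GOne W.piece where
  one := W.cls 0 ⟨1, W.one_mem⟩

instance gring : DirectSum.GRing W.piece where
  mul_zero x := map_zero (W.mulPiece _ _ x)
  zero_mul {i j} y := by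
    change W.mulPiece i j 0 y = 0
    rw [map_zero, LinearMap.zero_apply]
  mul_add x y y' := map_add (W.mulPiece _ _ x) _ _
  add_mul {i j} x x' y := by
    change W.mulPiece i j (x + x') y = W.mulPiece i j x y + W.mulPiece i j x' y
    rw [map_add, LinearMap.add_apply]
  one_mul := by
    rintro ⟨i, x⟩
    obtain ⟨x, rfl⟩ := Submodule.mkQ_surjective _ x
    exact W.mk_cls_eq (zero_add i) _ _ (one_mul _)
  mul_one := by
    rintro ⟨i, x⟩
    obtain ⟨x, rfl⟩ := Submodule.mkQ_surjective _ x
    exact W.mk_cls_eq (add_zero i) _ _ (mul_one _)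
  mul_assoc := by
    rintro ⟨i, x⟩ ⟨j, y⟩ ⟨l, z⟩
    obtain ⟨x, rfl⟩ := Submodule.mkQ_surjective _ x
    obtain ⟨y, rfl⟩ := Submodule.mkQ_surjective _ y
    obtain ⟨z, rfl⟩ := Submodule.mkQ_surjective _ z
    exact W.mk_cls_eq (add_assoc i j l) _ _ (mul_assoc _ _ _)
  natCast n := W.cls 0 ⟨n, W.natCast_mem n⟩
  natCast_zero := W.cls_eq_zero (by simp)
  natCast_succ n := by
    change W.cls 0 _ = W.cls 0 _ + W.cls 0 _
    rw [← map_add]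
    congr 1
    ext
    exact Nat.cast_succ n
  intCast n := W.cls 0 ⟨n, W.intCast_mem n⟩
  intCast_ofNat n := by
    congr 1
    ext
    exact Int.cast_natCast n
  intCast_negSucc_ofNat n := by
    rw [← map_neg]
    congr 1
    ext
    exact Int.cast_negSucc n

/-- The associated graded ring `gr R = ⨁_d F_d / F_{d-1}`. -/
def Gr : Type _ := ⨁ d, W.piece d

instance : Ring W.Gr := DirectSum.ring W.piece

/-- The symbol `σ_d(x) ∈ gr R` of an element `x ∈ F_d`. -/
def symbol (d : ℕ) (x : R) (hx : x ∈ W.F d) : W.Gr :=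
  DirectSum.of W.piece d (W.cls d ⟨x, hx⟩)

end AlgFiltration

/-! ### The enveloping algebra of the Hasse--Schmidt derivations -/

section Enveloping

variable (k : Type u) (A : Type v) [CommRing k] [CommRing A] [Algebra k A]

/-- The variables `S_a` (`a ∈ A`) and `T_{p,Δ,D,α}` (`D ∈ HS^p_k(A; Δ)`, `α ∈ Δ`). -/
inductive Gen : Type (max u v)
  | S (a : A) : Gen
  | T (p : ℕ) (Δ : Coideal p) (D : HS k A Δ) (α : Fin p →₀ ℕ) (hα : α ∈ Δ) : Gen

/-- The free `k`-algebra `𝕋_{A/k}`. -/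
abbrev FreeT : Type (max u v) := FreeAlgebra k (Gen k A)

variable {A}

/-- The variable `S_a` of `𝕋_{A/k}`. -/
abbrev varS (a : A) : FreeT k A := FreeAlgebra.ι k (Gen.S a)

variable {k}

/-- The variable `T_{p,Δ,D,α}` of `𝕋_{A/k}`. -/
abbrev varT {Δ : Coideal p} (D : HS k A Δ) (α : Fin p →₀ ℕ) (hα : α ∈ Δ) : FreeT k A :=
  FreeAlgebra.ι k (Gen.T p Δ D α hα)

variable (k A)

/-- The defining relations of `𝕌_{A/k}`: the two-sided ideal of relations is generated by the
differences of the two sides. -/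
inductive Rel : FreeT k A → FreeT k A → Prop
  | S_const (c : k) : Rel (varS k (algebraMap k A c)) (algebraMap k (FreeT k A) c)
  | S_add (a a' : A) : Rel (varS k (a + a')) (varS k a + varS k a')
  | S_mul (a a' : A) : Rel (varS k (a * a')) (varS k a * varS k a')
  | T_origin (p : ℕ) :
      Rel (varT (HS.one (Coideal.origin p)) 0 (Coideal.zero_mem _)) 1
  | T_one (p : ℕ) (Δ : Coideal p) (α : Fin p →₀ ℕ) (hα : α ∈ Δ) (h : 0 < α.degree) :
      Rel (varT (HS.one Δ) α hα) 0
  | T_comp (p : ℕ) (Δ : Coideal p) (D E : HS k A Δ) (α : Fin p →₀ ℕ) (hα : α ∈ Δ) :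
      Rel (varT (D.comp E) α hα)
        (∑ x ∈ (antidiagonal α).attach,
          varT D x.1.1 (Δ.fst_mem hα x.2) * varT E x.1.2 (Δ.snd_mem hα x.2))
  | T_leibniz (p : ℕ) (Δ : Coideal p) (D : HS k A Δ) (α : Fin p →₀ ℕ) (hα : α ∈ Δ) (a : A) :
      Rel (varT D α hα * varS k a)
        (∑ x ∈ (antidiagonal α).attach,
          varS k (D.coeff x.1.1 a) * varT D x.1.2 (Δ.snd_mem hα x.2))
  | T_bullet (p q : ℕ) (Δ : Coideal p) (Nb : Coideal q) (φ : SubstMap A Δ Nb) (D : HS k A Δ)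
      (β : Fin q →₀ ℕ) (hβ : β ∈ Nb) :
      Rel (varT (D.bullet φ) β hβ)
        (∑ α ∈ (Δ.upTo β.degree).attach,
          varS k (φ.C β α.1) * varT D α.1 (Coideal.mem_upTo.1 α.2).2)

/-- The enveloping algebra `𝕌_{A/k}` of the Hasse--Schmidt derivations of `A` over `k`. -/
def U : Type (max u v) := RingQuot (Rel k A)

instance : Ring (U k A) := inferInstanceAs (Ring (RingQuot (Rel k A)))

instance : Algebra k (U k A) := inferInstanceAs (Algebra k (RingQuot (Rel k A)))

/-- The quotient map `𝕋_{A/k} → 𝕌_{A/k}`. -/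
def toU : FreeT k A →ₐ[k] U k A := RingQuot.mkAlgHom k (Rel k A)

variable {k A}

/-- `ℓ_α(D) = min {r ≥ 1 : D_β ≠ 0 for some β ≤ α with |β| = r}` (`⊤` if there is no such `r`). -/
def HS.ell {Δ : Coideal p} (D : HS k A Δ) (α : Fin p →₀ ℕ) : ℕ∞ :=
  sInf {r | ∃ β ≤ α, 1 ≤ β.degree ∧ D.coeff β ≠ 0 ∧ r = (β.degree : ℕ∞)}

open scoped Classical in
/-- The degrees of the variables: `deg S_a = 0`, `deg T_{p,Δ,D,α} = ⌊|α| / ℓ_α(D)⌋`, which is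
`0` if `ℓ_α(D) = ∞`. -/
def Gen.deg : Gen k A → ℕ
  | Gen.S _ => 0
  | Gen.T _ _ D α _ => if D.ell α = ⊤ then 0 else α.degree / (D.ell α).toNat

variable (k A)

/-- `𝕋^{≤ d}`, the `k`-span of the monomials of degree at most `d`. -/
def FreeT.le (d : ℕ) : Submodule k (FreeT k A) :=
  Submodule.span k {x | ∃ l : List (Gen k A),
    (l.map Gen.deg).sum ≤ d ∧ x = (l.map (FreeAlgebra.ι k)).prod}

/-- The filtration of `𝕌_{A/k}` by the images of the `𝕋^{≤ d}`. -/
def filU : AlgFiltration k (U k A) where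
  F d := (FreeT.le k A d).map (toU k A).toLinearMap
  mono _ _ h := Submodule.map_mono (Submodule.span_mono fun _ ⟨l, hl, hx⟩ => ⟨l, hl.trans h, hx⟩)
  one_mem := ⟨1, Submodule.subset_span ⟨[], by simp, by simp⟩, map_one (toU k A)⟩
  mul_mem := by
    rintro i j _ _ ⟨x, hx, rfl⟩ ⟨y, hy, rfl⟩
    refine ⟨x * y, ?_, map_mul (toU k A) x y⟩
    have h := Submodule.mul_mem_mul hx hy
    rw [FreeT.le, FreeT.le, Submodule.span_mul_span] at h
    refine Submodule.span_mono ?_ h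
    rintro _ ⟨_, ⟨l, hl, rfl⟩, _, ⟨l', hl', rfl⟩, rfl⟩
    exact ⟨l ++ l', by rw [List.map_append, List.sum_append]; omega, by simp⟩

/-- The associated graded ring `gr 𝕌_{A/k}`. -/
abbrev GrU : Type (max u v) := (filU k A).Gr

variable {k A}

theorem toU_mem {x : Gen k A} {d : ℕ} (h : x.deg ≤ d) :
    toU k A (FreeAlgebra.ι k x) ∈ (filU k A).F d :=
  ⟨_, Submodule.subset_span ⟨[x], by simpa using h, by simp⟩, rfl⟩

theorem Gen.deg_T_le {Δ : Coideal p} (D : HS k A Δ) (α : Fin p →₀ ℕ) (hα : α ∈ Δ) :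
    (Gen.T p Δ D α hα).deg ≤ α.degree := by
  rw [Gen.deg]
  split_ifs
  · exact Nat.zero_le _
  · exact Nat.div_le_self _ _

variable (k) in
/-- The element `σ_0(𝐒_a)` of `gr 𝕌_{A/k}`. -/
def symS (a : A) : GrU k A :=
  (filU k A).symbol 0 (toU k A (varS k a)) (toU_mem le_rfl)

/-- The element `σ_m(𝐓_{1,m,D,m})` of `gr 𝕌_{A/k}`, for `D ∈ HS_k(A; m)`. -/
def symT {m : ℕ} (D : HS k A (Coideal.tot 1 m)) : GrU k A :=
  (filU k A).symbol m (toU k A (varT D (idx m) (idx_mem_tot le_rfl)))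
    (toU_mem ((Gen.deg_T_le D _ _).trans (Finsupp.degree_single _ _).le))

/-- `ϑ` is the canonical map of `A`-algebras `Γ_A Ider^f_k(A) → gr 𝕌_{A/k}`: it is compatible with
the ring maps from `A`, and `ϑ(γ_m(δ)) = σ_m(𝐓_{1,m,D,m})` for each `δ`, each `m ≥ 1` and each
`m`-integral `D` of `δ`. -/
structure IsTheta (ϑ : DividedPowerAlgebra A (IderF k A) →+* GrU k A) : Prop where
  map_algebraMap : ∀ a : A, ϑ (algebraMap A _ a) = symS k a
  map_dp : ∀ (δ : IderF k A) (m : ℕ), 1 ≤ m → ∀ D : HS k A (Coideal.tot 1 m),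
    D.coeff (idx 1) = (δ : Derivation k A A).toLinearMap →
      ϑ (DividedPowerAlgebra.dp A m δ) = symT D

end Enveloping

end HSEnv

end

/-!
The homomorphism `ϑ` exists because `gr 𝕌` is commutative and because the symbols
`σ_m(𝐓_{1,m,D,m})` depend only on `δ = D_1` and satisfy the relations of divided powers; it is
surjective, when every derivation is f-integrable, because every Hasse--Schmidt derivation is, up to
any given index, a product of integrals of derivations in which the variable is replaced by a
monomial.

Everything rests on division in the group of Hasse--Schmidt derivations. For `H` and `G` in the same
group there is `K` with `K ∘ G = H` (`HS.div`), and `K` is trivial at each index below which `H` and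
`G` coincide (`HS.div_coeff_eq_zero`). Since truncations are substitution maps, an operator
`𝐓_{K,α}` vanishes as soon as `K` is trivial at the indices below `α ≠ 0` (`opT_eq_zero`), and has
degree at most `⌊|α| / l⌋` if `K` vanishes in the degrees `1, …, l - 1` (`opT_mem`).

* Commutativity (`opT_mul_opT_sub_mem`). Put `D` and `E` into two separate groups of variables. The
  operators `𝐓_{D,α} 𝐓_{E,β}` and `𝐓_{E,β} 𝐓_{D,α}` belong to `D ∘ E` and `E ∘ D` at the index
  `(α, β)`, and the quotient `K` of these two vanishes at `(a, b)` unless `|a| ≥ ℓ(D)` and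
  `|b| ≥ ℓ(E)`. The degree then drops by `⌊(x + y) / (l + m)⌋ < ⌊x / l⌋ + ⌊y / m⌋` for `x ≥ l`,
  `y ≥ m`.
* Symbols (`opT_sub_mem_of_agree`). If `H` and `G` have the same components of order one, then `K`
  vanishes in degree one, and `𝐓_{H,α}`, `𝐓_{G,α}` have the same symbol in degree `|α|`. Hence
  `σ_m(𝐓_{1,m,D,m})` depends only on `D_1`. The relations for `γ_n(a δ)` and `γ_n(δ + ε)` come from
  the substitution `s ↦ a s` and from the product `D ∘ E`; the relation for `γ_m(δ) γ_n(δ)` comes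
  from comparing the external product of `D` with itself and the image of `D` under `s ↦ s + t`,
  whose component of index `(i, j)` is `(i+j choose i) D_{i+j}` (`gammaGr_mul`).
* Surjectivity (`symbolMem_opT_below`). A non-zero component `D_β` of least degree is a derivation.
  If it is integrable, with integral `E`, then dividing `D` by the image of `E` under `s ↦ s^β`
  removes the component `D_β` and changes no other component of the same or of smaller degree. By
  repetition `𝐓_{D,α}` becomes a sum of products of operators `𝐓_{1,m,E,n}` of total degree at most
  the degree of `𝐓_{D,α}`.
-/

noncomputable section

namespace HSEnv

open Finset.HasAntidiagonal (antidiagonal mem_antidiagonal)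

universe u v

variable {p q : ℕ} {k : Type u} {A : Type v} [CommRing k] [CommRing A] [Algebra k A]

/-! ### Substitution maps given by their coefficients -/

theorem degree_fst_le {e : Fin q →₀ ℕ} {x : (Fin q →₀ ℕ) × (Fin q →₀ ℕ)}
    (hx : x ∈ antidiagonal e) : x.1.degree ≤ e.degree := by
  rw [← mem_antidiagonal.1 hx, map_add]
  exact Nat.le_add_right _ _

theorem degree_snd_le {e : Fin q →₀ ℕ} {x : (Fin q →₀ ℕ) × (Fin q →₀ ℕ)}
    (hx : x ∈ antidiagonal e) : x.2.degree ≤ e.degree := by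
  rw [← mem_antidiagonal.1 hx, map_add]
  exact Nat.le_add_left _ _

/-- A sum of Cauchy products weighted by `c` is a double sum, if `c` vanishes outside the range of
summation. -/
theorem sum_upTo_mul_sum_upTo {Δ : Coideal p} {n : ℕ} (c : (Fin p →₀ ℕ) → A)
    (hc : ∀ α, α ∉ Δ.upTo n → c α = 0) (f g : (Fin p →₀ ℕ) → A) :
    ∑ α ∈ Δ.upTo n, c α * ∑ x ∈ antidiagonal α, f x.1 * g x.2 =
      ∑ α ∈ Δ.upTo n, ∑ β ∈ Δ.upTo n, c (α + β) * (f α * g β) := by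
  classical
  have key : ∀ α ∈ Δ.upTo n, c α * ∑ x ∈ antidiagonal α, f x.1 * g x.2 =
      ∑ x ∈ (Δ.upTo n ×ˢ Δ.upTo n) with x.1 + x.2 = α, c (x.1 + x.2) * (f x.1 * g x.2) := by
    intro α hα
    rw [Finset.mul_sum]
    refine Finset.sum_congr ?_ ?_
    · ext x
      rw [Finset.mem_filter, mem_antidiagonal, Finset.mem_product]
      refine ⟨fun hx => ⟨?_, hx⟩, fun hx => hx.2⟩
      obtain ⟨hn, hΔ⟩ := Coideal.mem_upTo.1 hα
      have hx' := mem_antidiagonal.2 hx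
      exact ⟨Coideal.mem_upTo.2 ⟨(degree_fst_le hx').trans hn, Δ.fst_mem hΔ hx'⟩,
        Coideal.mem_upTo.2 ⟨(degree_snd_le hx').trans hn, Δ.snd_mem hΔ hx'⟩⟩
    · intro x hx
      rw [(Finset.mem_filter.1 hx).2]
  rw [Finset.sum_congr rfl key, ← Finset.sum_product']
  rw [← Finset.sum_filter_add_sum_filter_not (Δ.upTo n ×ˢ Δ.upTo n)
    (fun x => x.1 + x.2 ∈ Δ.upTo n)]
  refine Eq.trans ?_ (add_eq_left.2 (Finset.sum_eq_zero fun x hx => ?_)).symm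
  · rw [← Finset.sum_fiberwise_of_maps_to (t := Δ.upTo n)
      (g := fun x : (Fin p →₀ ℕ) × (Fin p →₀ ℕ) => x.1 + x.2)
      (fun x hx => (Finset.mem_filter.1 hx).2)]
    refine Finset.sum_congr rfl fun α hα => Finset.sum_congr ?_ fun _ _ => rfl
    rw [Finset.filter_filter]
    refine Finset.filter_congr fun x _ => ?_
    exact ⟨fun h => ⟨h ▸ hα, h⟩, fun h => h.2⟩
  · rw [hc _ (Finset.mem_filter.1 hx).2, zero_mul]

/-- The truncated series `∑_e f(e) t^e`. -/
def TPS.ofFun (Nb : Coideal q) (f : (Fin q →₀ ℕ) → A) : TPS A Nb :=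
  TPS.mk Nb (f : MvPowerSeries (Fin q) A)

theorem TPS.coeff_ofFun {Nb : Coideal q} (f : (Fin q →₀ ℕ) → A) {e : Fin q →₀ ℕ} (he : e ∈ Nb) :
    TPS.coeff Nb e (TPS.ofFun Nb f) = f e :=
  TPS.coeff_mk he _

/-- The substitution map `s^α ↦ ∑_e c(e, α) t^e`, for a family of coefficients `c` that is
multiplicative in `α`. -/
def SubstMap.ofCoeff {Δ : Coideal p} {Nb : Coideal q} (c : (Fin q →₀ ℕ) → (Fin p →₀ ℕ) → A)
    (hdeg : ∀ e α, e.degree < α.degree → c e α = 0)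
    (hmem : ∀ e ∈ Nb, ∀ α, α ∉ Δ → c e α = 0)
    (h0 : ∀ e, c e 0 = if e = 0 then 1 else 0)
    (hmul : ∀ e ∈ Nb, ∀ α α', c e (α + α') = ∑ x ∈ antidiagonal e, c x.1 α * c x.2 α') :
    SubstMap A Δ Nb where
  toAlgHom := AlgHom.ofLinearMap
    { toFun := fun f => TPS.ofFun Nb fun e => ∑ α ∈ Δ.upTo e.degree, c e α * TPS.coeff Δ α f
      map_add' := fun f g => TPS.ext fun e he => by
        rw [map_add, TPS.coeff_ofFun _ he, TPS.coeff_ofFun _ he, TPS.coeff_ofFun _ he,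
          ← Finset.sum_add_distrib]
        exact Finset.sum_congr rfl fun α _ => by rw [map_add, mul_add]
      map_smul' := fun a f => TPS.ext fun e he => by
        rw [RingHom.id_apply, map_smul, TPS.coeff_ofFun _ he, TPS.coeff_ofFun _ he,
          Finset.smul_sum]
        exact Finset.sum_congr rfl fun α _ => by
          rw [map_smul, smul_eq_mul, smul_eq_mul, mul_left_comm] }
    (TPS.ext fun e he => by
      change TPS.coeff Nb e (TPS.ofFun Nb _) = TPS.coeff Nb e (TPS.mk Nb 1)
      rw [TPS.coeff_ofFun _ he, TPS.coeff_mk he, MvPowerSeries.coeff_one, ← h0]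
      change ∑ α ∈ Δ.upTo e.degree, c e α * TPS.coeff Δ α (TPS.mk Δ 1) = _
      rw [Finset.sum_eq_single 0]
      · rw [TPS.coeff_mk Δ.zero_mem, MvPowerSeries.coeff_one, if_pos rfl, mul_one]
      · intro α hα hne
        rw [TPS.coeff_mk (Coideal.mem_upTo.1 hα).2, MvPowerSeries.coeff_one, if_neg hne, mul_zero]
      · intro h
        exact absurd (Coideal.mem_upTo.2 ⟨by simp, Δ.zero_mem⟩) h)
    (fun f g => TPS.ext fun e he => by
      rw [TPS.coeff_mul he]
      change TPS.coeff Nb e (TPS.ofFun Nb _) = ∑ x ∈ antidiagonal e,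
        TPS.coeff Nb x.1 (TPS.ofFun Nb _) * TPS.coeff Nb x.2 (TPS.ofFun Nb _)
      have hext : ∀ (h : TPS A Δ) (e' : Fin q →₀ ℕ), e'.degree ≤ e.degree →
          ∑ α ∈ Δ.upTo e'.degree, c e' α * TPS.coeff Δ α h =
            ∑ α ∈ Δ.upTo e.degree, c e' α * TPS.coeff Δ α h := by
        intro h e' hle
        refine Finset.sum_subset (fun α hα => ?_) fun α hα hα' => ?_
        · have := Coideal.mem_upTo.1 hα
          exact Coideal.mem_upTo.2 ⟨this.1.trans hle, this.2⟩
        · rw [hdeg, zero_mul]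
          by_contra! hlt
          exact hα' (Coideal.mem_upTo.2 ⟨hlt, (Coideal.mem_upTo.1 hα).2⟩)
      rw [TPS.coeff_ofFun _ he]
      have h1 : ∀ α ∈ Δ.upTo e.degree, c e α * TPS.coeff Δ α (f * g) =
          c e α * ∑ x ∈ antidiagonal α, TPS.coeff Δ x.1 f * TPS.coeff Δ x.2 g := fun α hα => by
        rw [TPS.coeff_mul (Coideal.mem_upTo.1 hα).2]
      rw [Finset.sum_congr rfl h1, sum_upTo_mul_sum_upTo (fun α => c e α) ?_
        (fun α => TPS.coeff Δ α f) (fun α => TPS.coeff Δ α g)]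
      · have h2 : ∀ x ∈ antidiagonal e,
            TPS.coeff Nb x.1
                (TPS.ofFun Nb fun e => ∑ α ∈ Δ.upTo e.degree, c e α * TPS.coeff Δ α f) *
              TPS.coeff Nb x.2
                (TPS.ofFun Nb fun e => ∑ α ∈ Δ.upTo e.degree, c e α * TPS.coeff Δ α g) =
            ∑ α ∈ Δ.upTo e.degree, ∑ β ∈ Δ.upTo e.degree,
              c x.1 α * c x.2 β * (TPS.coeff Δ α f * TPS.coeff Δ β g) := by
          intro x hx
          rw [TPS.coeff_ofFun _ (Nb.fst_mem he hx), TPS.coeff_ofFun _ (Nb.snd_mem he hx),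
            hext f _ (degree_fst_le hx), hext g _ (degree_snd_le hx), Finset.sum_mul_sum]
          exact Finset.sum_congr rfl fun α _ => Finset.sum_congr rfl fun β _ =>
            mul_mul_mul_comm _ _ _ _
        refine Eq.trans (Eq.trans ?_ Finset.sum_comm) (Finset.sum_congr rfl h2).symm
        refine Finset.sum_congr rfl fun α _ =>
          Eq.trans (Finset.sum_congr rfl fun β _ => ?_) Finset.sum_comm
        rw [hmul e he, Finset.sum_mul]
      · intro α hα
        by_cases h : α ∈ Δ
        · refine hdeg e α ?_
          by_contra! hlt
          exact hα (Coideal.mem_upTo.2 ⟨hlt, h⟩)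
        · exact hmem e he α h)
  order_pos i := by
    change TPS.coeff Nb 0 (TPS.ofFun Nb _) = 0
    rw [TPS.coeff_ofFun _ Nb.zero_mem]
    refine Finset.sum_eq_zero fun α hα => ?_
    have hα' := Coideal.mem_upTo.1 hα
    have h00 : α = 0 := (Finsupp.degree_eq_zero_iff α).1 (by simpa using hα'.1)
    rw [TPS.coeff_mk hα'.2, MvPowerSeries.coeff_X, if_neg, mul_zero]
    rw [h00]
    intro h
    have := DFunLike.congr_fun h i
    simp at this

theorem SubstMap.C_ofCoeff {Δ : Coideal p} {Nb : Coideal q}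
    (c : (Fin q →₀ ℕ) → (Fin p →₀ ℕ) → A)
    (hdeg : ∀ e α, e.degree < α.degree → c e α = 0)
    (hmem : ∀ e ∈ Nb, ∀ α, α ∉ Δ → c e α = 0)
    (h0 : ∀ e, c e 0 = if e = 0 then 1 else 0)
    (hmul : ∀ e ∈ Nb, ∀ α α', c e (α + α') = ∑ x ∈ antidiagonal e, c x.1 α * c x.2 α')
    {e : Fin q →₀ ℕ} (he : e ∈ Nb) {α : Fin p →₀ ℕ} (hα : α ∈ Δ) :
    (SubstMap.ofCoeff (Δ := Δ) c hdeg hmem h0 hmul).C e α = c e α := by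
  classical
  change TPS.coeff Nb e (TPS.ofFun Nb _) = _
  rw [TPS.coeff_ofFun _ he]
  have h1 : ∀ β ∈ Δ.upTo e.degree,
      c e β * TPS.coeff Δ β (TPS.mk Δ (MvPowerSeries.monomial α 1)) =
        if β = α then c e α else 0 := by
    intro β hβ
    rw [TPS.coeff_mk (Coideal.mem_upTo.1 hβ).2, MvPowerSeries.coeff_monomial]
    split_ifs with h
    · rw [h, mul_one]
    · rw [mul_zero]
  rw [Finset.sum_congr rfl h1, Finset.sum_ite_eq']
  split_ifs with h
  · rfl
  · refine (hdeg e α ?_).symm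
    by_contra! hlt
    exact h (Coideal.mem_upTo.2 ⟨hlt, hα⟩)

/-- The substitution map `s^α ↦ a^{|α|} t^{μ(α)}`, for an additive map `μ` of multi-indices. -/
def monomialSubst {Δ : Coideal p} {Nb : Coideal q} (μ : (Fin p →₀ ℕ) →+ (Fin q →₀ ℕ)) (a : A)
    (hμ : ∀ α, α.degree ≤ (μ α).degree) (hmem : ∀ α, μ α ∈ Nb → α ∈ Δ) : SubstMap A Δ Nb :=
  SubstMap.ofCoeff (fun e α => if e = μ α then a ^ α.degree else 0)
    (fun e α h => if_neg fun h' => by rw [h'] at h; exact absurd (hμ α) (not_le.2 h))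
    (fun e he α hα => if_neg fun h : e = μ α => hα (hmem α (h ▸ he)))
    (fun e => by rw [map_zero, map_zero, pow_zero])
    (fun e _ α α' => by
      by_cases h : e = μ (α + α')
      · rw [if_pos h, Finset.sum_eq_single (μ α, μ α')]
        · rw [if_pos rfl, if_pos rfl, map_add, pow_add]
        · intro x _ hx
          by_cases h1 : x.1 = μ α
          · rw [if_neg (fun h2 : x.2 = μ α' => hx (Prod.ext h1 h2)), mul_zero]
          · rw [if_neg h1, zero_mul]
        · intro h'
          exact absurd (mem_antidiagonal.2 (by rw [h, map_add])) h'
      · rw [if_neg h, Finset.sum_eq_zero]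
        intro x hx
        by_cases h1 : x.1 = μ α
        · rw [if_neg (fun h2 : x.2 = μ α' => h ?_), mul_zero]
          rw [← mem_antidiagonal.1 hx, h1, h2, map_add]
        · rw [if_neg h1, zero_mul])

theorem C_monomialSubst {Δ : Coideal p} {Nb : Coideal q} (μ : (Fin p →₀ ℕ) →+ (Fin q →₀ ℕ))
    (a : A) (hμ : ∀ α, α.degree ≤ (μ α).degree) (hmem : ∀ α, μ α ∈ Nb → α ∈ Δ)
    {e : Fin q →₀ ℕ} (he : e ∈ Nb) {α : Fin p →₀ ℕ} (hα : α ∈ Δ) :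
    (monomialSubst (Δ := Δ) μ a hμ hmem).C e α = if e = μ α then a ^ α.degree else 0 :=
  SubstMap.C_ofCoeff _ _ _ _ _ he hα

/-! ### Division in the group of Hasse--Schmidt derivations -/

theorem HS.comp_coeff {Δ : Coideal p} (D E : HS k A Δ) {α : Fin p →₀ ℕ} (hα : α ∈ Δ) :
    (D.comp E).coeff α = ∑ x ∈ antidiagonal α, D.coeff x.1 ∘ₗ E.coeff x.2 :=
  if_pos hα

theorem degree_lt_of_ne {α : Fin p →₀ ℕ} {x : (Fin p →₀ ℕ) × (Fin p →₀ ℕ)}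
    (hx : x ∈ antidiagonal α) (hne : x ≠ (α, 0)) : x.1.degree < α.degree := by
  have h := mem_antidiagonal.1 hx
  have h2 : x.2 ≠ 0 := fun h2 => hne (Prod.ext (by rw [← h, h2, add_zero]) h2)
  have hp : 0 < x.2.degree := Nat.pos_of_ne_zero fun h0 =>
    h2 ((Finsupp.degree_eq_zero_iff _).1 h0)
  rw [← h, map_add]
  omega

theorem sum_antidiagonal_eq_add {M : Type*} [AddCommMonoid M] (α : Fin p →₀ ℕ)
    (f : (Fin p →₀ ℕ) × (Fin p →₀ ℕ) → M) :
    ∑ x ∈ antidiagonal α, f x = f (α, 0) + ∑ x ∈ (antidiagonal α).erase (α, 0), f x :=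
  (Finset.add_sum_erase _ _ (by simp)).symm

/-- The components of the solution `K` of `K ∘ G = H`, by recursion on the degree. -/
def divCoeff {Δ : Coideal p} (H G : HS k A Δ) (α : Fin p →₀ ℕ) : A →ₗ[k] A :=
  H.coeff α - ∑ x ∈ ((antidiagonal α).erase (α, 0)).attach,
    have : x.1.1.degree < α.degree :=
      degree_lt_of_ne (Finset.mem_of_mem_erase x.2) (Finset.ne_of_mem_erase x.2)
    divCoeff H G x.1.1 ∘ₗ G.coeff x.1.2
termination_by α.degree

theorem divCoeff_spec {Δ : Coideal p} (H G : HS k A Δ) (α : Fin p →₀ ℕ) :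
    ∑ x ∈ antidiagonal α, divCoeff H G x.1 ∘ₗ G.coeff x.2 = H.coeff α := by
  rw [sum_antidiagonal_eq_add, G.coeff_zero, divCoeff,
    Finset.sum_attach ((antidiagonal α).erase (α, 0))
      (fun x => divCoeff H G x.1 ∘ₗ G.coeff x.2)]
  exact sub_add_cancel _ _

theorem divCoeff_leibniz {Δ : Coideal p} (H G : HS k A Δ) (α : Fin p →₀ ℕ) (hα : α ∈ Δ) :
    ∀ x y : A, divCoeff H G α (x * y) =
      ∑ b ∈ antidiagonal α, divCoeff H G b.1 x * divCoeff H G b.2 y := by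
  induction hn : α.degree using Nat.strong_induction_on generalizing α with
  | _ n ih' =>
    intro x y
    have hspec : ∀ β z, H.coeff β z =
        ∑ c ∈ antidiagonal β, divCoeff H G c.1 (G.coeff c.2 z) := by
      intro β z
      rw [← divCoeff_spec H G β, LinearMap.sum_apply]
      rfl
    have h1 : H.coeff α (x * y) = ∑ c ∈ antidiagonal α, ∑ z ∈ antidiagonal c.2,
        ∑ w ∈ antidiagonal c.1,
          divCoeff H G w.1 (G.coeff z.1 x) * divCoeff H G w.2 (G.coeff z.2 y) := by
      rw [H.leibniz α hα, sum_antidiagonal_swap α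
        (fun a b c d => divCoeff H G a (G.coeff c x) * divCoeff H G b (G.coeff d y))]
      exact Finset.sum_congr rfl fun c _ => by rw [hspec, hspec, Finset.sum_mul_sum]
    have h2 : H.coeff α (x * y) = ∑ c ∈ antidiagonal α, ∑ z ∈ antidiagonal c.2,
        divCoeff H G c.1 (G.coeff z.1 x * G.coeff z.2 y) := by
      rw [hspec]
      refine Finset.sum_congr rfl fun c hc => ?_
      rw [G.leibniz _ (Δ.snd_mem hα hc), map_sum]
    rw [sum_antidiagonal_eq_add] at h1 h2
    have h3 : ∀ c ∈ (antidiagonal α).erase (α, 0), ∑ z ∈ antidiagonal c.2,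
        divCoeff H G c.1 (G.coeff z.1 x * G.coeff z.2 y) = ∑ z ∈ antidiagonal c.2,
        ∑ w ∈ antidiagonal c.1,
          divCoeff H G w.1 (G.coeff z.1 x) * divCoeff H G w.2 (G.coeff z.2 y) := by
      intro c hc
      have hc' := Finset.mem_of_mem_erase hc
      have hlt := degree_lt_of_ne hc' (Finset.ne_of_mem_erase hc)
      exact Finset.sum_congr rfl fun z _ => ih' _ (hn ▸ hlt) _ (Δ.fst_mem hα hc') rfl _ _
    rw [Finset.sum_congr rfl h3, h1] at h2
    have h4 := add_right_cancel h2
    simp only [Finsupp.antidiagonal_zero, Finset.sum_singleton, G.coeff_zero,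
      LinearMap.id_apply] at h4
    exact h4.symm

open scoped Classical in
/-- The quotient `H ∘ G⁻¹`. -/
def HS.div {Δ : Coideal p} (H G : HS k A Δ) : HS k A Δ where
  coeff α := if α ∈ Δ then divCoeff H G α else 0
  coeff_notMem α hα := if_neg hα
  coeff_zero := by
    have h := divCoeff_spec H G 0
    rw [Finsupp.antidiagonal_zero, Finset.sum_singleton, G.coeff_zero, H.coeff_zero] at h
    rw [if_pos Δ.zero_mem]
    exact h
  leibniz α hα x y := by
    rw [if_pos hα, divCoeff_leibniz H G α hα]
    exact Finset.sum_congr rfl fun b hb => by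
      rw [if_pos (Δ.fst_mem hα hb), if_pos (Δ.snd_mem hα hb)]

theorem HS.div_coeff {Δ : Coideal p} (H G : HS k A Δ) {α : Fin p →₀ ℕ} (hα : α ∈ Δ) :
    (H.div G).coeff α = divCoeff H G α :=
  if_pos hα

theorem HS.div_comp {Δ : Coideal p} (H G : HS k A Δ) : (H.div G).comp G = H := by
  ext1
  funext α
  by_cases hα : α ∈ Δ
  · rw [HS.comp_coeff _ _ hα, ← divCoeff_spec H G α]
    exact Finset.sum_congr rfl fun x hx => by
      rw [HS.div_coeff _ _ (Δ.fst_mem hα hx)]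
  · rw [HS.coeff_notMem _ α hα, HS.coeff_notMem _ α hα]

/-- The quotient `H ∘ G⁻¹` is trivial wherever `H` and `G` coincide on all smaller indices. -/
theorem HS.div_coeff_eq_zero {Δ : Coideal p} (H G : HS k A Δ) {α : Fin p →₀ ℕ} (hα : α ∈ Δ)
    (h0 : α ≠ 0) (h : ∀ β ≤ α, H.coeff β = G.coeff β) : (H.div G).coeff α = 0 := by
  induction hn : α.degree using Nat.strong_induction_on generalizing α with
  | _ n ih =>
    have h1 : H.coeff α = ((H.div G).comp G).coeff α := by rw [HS.div_comp]
    rw [HS.comp_coeff _ _ hα, sum_antidiagonal_eq_add, Finset.sum_eq_single (0, α),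
      HS.coeff_zero, HS.coeff_zero, h α le_rfl] at h1
    · exact add_eq_right.1 h1.symm
    · intro x hx hne
      have hx' := Finset.mem_of_mem_erase hx
      have hlt := degree_lt_of_ne hx' (Finset.ne_of_mem_erase hx)
      have hle : x.1 ≤ α := by rw [← mem_antidiagonal.1 hx']; exact le_self_add
      rw [ih _ (hn ▸ hlt) (Δ.fst_mem hα hx') ?_ (fun β hβ => h β (hβ.trans hle)) rfl,
        LinearMap.zero_comp]
      intro h1
      refine hne (Prod.ext h1 ?_)
      rw [← mem_antidiagonal.1 hx', h1, zero_add]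
    · intro hx
      exact absurd (by simp [Ne.symm h0]) hx

/-! ### The generators in the enveloping algebra -/

theorem toU_rel {x y : FreeT k A} (h : Rel k A x y) : toU k A x = toU k A y :=
  RingQuot.mkAlgHom_rel k h

variable (k) in
/-- The element `𝐒_a` of `𝕌_{A/k}`, as a ring homomorphism in `a`. -/
def opS : A →+* U k A where
  toFun a := toU k A (varS k a)
  map_one' := by
    have h := toU_rel (Rel.S_const (k := k) (A := A) 1)
    rwa [map_one, map_one, map_one] at h
  map_mul' a b := (toU_rel (Rel.S_mul a b)).trans (map_mul _ _ _)
  map_zero' := by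
    have h := toU_rel (Rel.S_const (k := k) (A := A) 0)
    rwa [map_zero, map_zero, map_zero] at h
  map_add' a b := (toU_rel (Rel.S_add a b)).trans (map_add _ _ _)

theorem opS_algebraMap (c : k) : opS k (algebraMap k A c) = algebraMap k (U k A) c :=
  (toU_rel (Rel.S_const c)).trans (AlgHom.commutes _ _)

open scoped Classical in
/-- The element `𝐓_{p,Δ,D,α}` of `𝕌_{A/k}`, extended by zero to the indices outside `Δ`. -/
def opT {Δ : Coideal p} (D : HS k A Δ) (α : Fin p →₀ ℕ) : U k A :=
  if hα : α ∈ Δ then toU k A (varT D α hα) else 0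

theorem opT_of_mem {Δ : Coideal p} (D : HS k A Δ) {α : Fin p →₀ ℕ} (hα : α ∈ Δ) :
    opT D α = toU k A (varT D α hα) :=
  dif_pos hα

theorem opT_of_notMem {Δ : Coideal p} (D : HS k A Δ) {α : Fin p →₀ ℕ} (hα : α ∉ Δ) :
    opT D α = 0 :=
  dif_neg hα

theorem opT_comp {Δ : Coideal p} (D E : HS k A Δ) {α : Fin p →₀ ℕ} (hα : α ∈ Δ) :
    opT (D.comp E) α = ∑ x ∈ antidiagonal α, opT D x.1 * opT E x.2 := by
  rw [opT_of_mem _ hα, toU_rel (Rel.T_comp p Δ D E α hα), map_sum,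
    ← Finset.sum_attach (antidiagonal α)]
  exact Finset.sum_congr rfl fun x _ => by
    rw [opT_of_mem D (Δ.fst_mem hα x.2), opT_of_mem E (Δ.snd_mem hα x.2), map_mul]

theorem opT_mul_opS {Δ : Coideal p} (D : HS k A Δ) {α : Fin p →₀ ℕ} (hα : α ∈ Δ) (a : A) :
    opT D α * opS k a = ∑ x ∈ antidiagonal α, opS k (D.coeff x.1 a) * opT D x.2 := by
  have h := toU_rel (Rel.T_leibniz p Δ D α hα a)
  rw [map_mul, map_sum] at h
  rw [opT_of_mem _ hα, ← Finset.sum_attach (antidiagonal α)]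
  refine Eq.trans h (Finset.sum_congr rfl fun x _ => ?_)
  rw [opT_of_mem D (Δ.snd_mem hα x.2), map_mul]
  rfl

theorem opT_bullet {Δ : Coideal p} {Nb : Coideal q} (φ : SubstMap A Δ Nb) (D : HS k A Δ)
    {β : Fin q →₀ ℕ} (hβ : β ∈ Nb) :
    opT (D.bullet φ) β = ∑ α ∈ Δ.upTo β.degree, opS k (φ.C β α) * opT D α := by
  rw [opT_of_mem _ hβ, toU_rel (Rel.T_bullet p q Δ Nb φ D β hβ), map_sum,
    ← Finset.sum_attach (Δ.upTo β.degree)]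
  refine Finset.sum_congr rfl fun x _ => ?_
  rw [opT_of_mem D (Coideal.mem_upTo.1 x.2).2, map_mul]
  rfl

section Monomial

variable {Δ : Coideal p} {Nb : Coideal q} (μ : (Fin p →₀ ℕ) →+ (Fin q →₀ ℕ)) (a : A)
  (hμ : ∀ α, α.degree ≤ (μ α).degree) (hmem : ∀ α, μ α ∈ Nb → α ∈ Δ) (D : HS k A Δ)

theorem bullet_coeff {Δ : Coideal p} {Nb : Coideal q} (φ : SubstMap A Δ Nb) (D : HS k A Δ)
    (e : Fin q →₀ ℕ) :
    (D.bullet φ).coeff e = ∑ α ∈ Δ.upTo e.degree, φ.C e α • D.coeff α :=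
  rfl

theorem bullet_monomialSubst_coeff (hinj : Function.Injective μ) {α : Fin p →₀ ℕ}
    (hα : μ α ∈ Nb) :
    (D.bullet (monomialSubst μ a hμ hmem)).coeff (μ α) = a ^ α.degree • D.coeff α := by
  rw [bullet_coeff, Finset.sum_eq_single α]
  · rw [C_monomialSubst μ a hμ hmem hα (hmem α hα), if_pos rfl]
  · intro β hβ hne
    rw [C_monomialSubst μ a hμ hmem hα (Coideal.mem_upTo.1 hβ).2,
      if_neg fun h => hne (hinj h).symm, zero_smul]
  · intro h
    exact absurd (Coideal.mem_upTo.2 ⟨hμ α, hmem α hα⟩) h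

theorem bullet_monomialSubst_coeff_eq_zero {e : Fin q →₀ ℕ} (h : ∀ α, e ≠ μ α) :
    (D.bullet (monomialSubst μ a hμ hmem)).coeff e = 0 := by
  by_cases he : e ∈ Nb
  · refine Finset.sum_eq_zero fun β hβ => ?_
    rw [C_monomialSubst μ a hμ hmem he (Coideal.mem_upTo.1 hβ).2, if_neg (h β), zero_smul]
  · exact HS.coeff_notMem _ _ he

theorem opT_bullet_monomialSubst (hinj : Function.Injective μ) {α : Fin p →₀ ℕ}
    (hα : μ α ∈ Nb) :
    opT (D.bullet (monomialSubst μ a hμ hmem)) (μ α) = opS k (a ^ α.degree) * opT D α := by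
  rw [opT_bullet _ _ hα, Finset.sum_eq_single α]
  · rw [C_monomialSubst μ a hμ hmem hα (hmem α hα), if_pos rfl]
  · intro β hβ hne
    rw [C_monomialSubst μ a hμ hmem hα (Coideal.mem_upTo.1 hβ).2,
      if_neg fun h => hne (hinj h).symm, map_zero, zero_mul]
  · intro h
    exact absurd (Coideal.mem_upTo.2 ⟨hμ α, hmem α hα⟩) h

theorem opT_bullet_monomialSubst_eq_zero {e : Fin q →₀ ℕ} (h : ∀ α, e ≠ μ α) :
    opT (D.bullet (monomialSubst μ a hμ hmem)) e = 0 := by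
  by_cases he : e ∈ Nb
  · rw [opT_bullet _ _ he]
    refine Finset.sum_eq_zero fun β hβ => ?_
    rw [C_monomialSubst μ a hμ hmem he (Coideal.mem_upTo.1 hβ).2, if_neg (h β), map_zero,
      zero_mul]
  · exact opT_of_notMem _ he

end Monomial

/-! ### Truncation and the order filtration -/

/-- The truncation of a Hasse--Schmidt derivation to a smaller co-ideal. -/
def HS.trunc {Δ : Coideal p} (D : HS k A Δ) (Nb : Coideal p) (h : ∀ e ∈ Nb, e ∈ Δ) : HS k A Nb :=
  D.bullet (monomialSubst (AddMonoidHom.id _) 1 (fun _ => le_rfl) h)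

theorem HS.trunc_coeff {Δ : Coideal p} (D : HS k A Δ) {Nb : Coideal p} (h : ∀ e ∈ Nb, e ∈ Δ)
    {e : Fin p →₀ ℕ} (he : e ∈ Nb) : (D.trunc Nb h).coeff e = D.coeff e := by
  have := bullet_monomialSubst_coeff (AddMonoidHom.id _) 1 (fun _ => le_rfl) h D
    Function.injective_id he
  rwa [one_pow, one_smul] at this

theorem opT_trunc {Δ : Coideal p} (D : HS k A Δ) {Nb : Coideal p} (h : ∀ e ∈ Nb, e ∈ Δ)
    {e : Fin p →₀ ℕ} (he : e ∈ Nb) : opT (D.trunc Nb h) e = opT D e := by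
  have := opT_bullet_monomialSubst (AddMonoidHom.id _) 1 (fun _ => le_rfl) h D
    Function.injective_id he
  rwa [one_pow, map_one, one_mul] at this

/-- The co-ideal `{β : β ≤ α}`. -/
def Coideal.below (α : Fin p →₀ ℕ) : Coideal p where
  carrier := Set.Iic α
  nonempty := ⟨α, Set.mem_Iic.2 le_rfl⟩
  lower := isLowerSet_Iic α

theorem Coideal.mem_below {α β : Fin p →₀ ℕ} : β ∈ Coideal.below α ↔ β ≤ α :=
  Set.mem_Iic

theorem HS.eq_one {Δ : Coideal p} (D : HS k A Δ) (h : ∀ β ∈ Δ, β ≠ 0 → D.coeff β = 0) :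
    D = HS.one Δ := by
  ext1
  funext β
  by_cases h0 : β = 0
  · rw [h0, HS.coeff_zero, HS.coeff_zero]
  · refine Eq.trans ?_ (if_neg h0).symm
    by_cases hβ : β ∈ Δ
    · exact h β hβ h0
    · exact D.coeff_notMem β hβ

theorem opT_zero {Δ : Coideal p} (D : HS k A Δ) : opT D 0 = 1 := by
  have h : ∀ e ∈ Coideal.origin p, e ∈ Δ := fun e he => by
    rw [show e = 0 from he]
    exact Δ.zero_mem
  rw [← opT_trunc D h (Coideal.zero_mem _),
    HS.eq_one (D.trunc _ h) fun β hβ h0 => absurd hβ h0, opT_of_mem _ (Coideal.zero_mem _),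
    toU_rel (Rel.T_origin p), map_one]

/-- If `D` is trivial on the indices below `α ≠ 0` then its truncation is the identity, so that
`𝐓_{D,α} = 0`. -/
theorem opT_eq_zero {Δ : Coideal p} (D : HS k A Δ) {α : Fin p →₀ ℕ} (hα : α ≠ 0)
    (h : ∀ β ≤ α, β ≠ 0 → D.coeff β = 0) : opT D α = 0 := by
  by_cases hmem : α ∈ Δ
  · have hle : ∀ e ∈ Coideal.below α, e ∈ Δ := fun e he => Δ.mem_of_le (Coideal.mem_below.1 he) hmem
    have hαα : α ∈ Coideal.below α := Coideal.mem_below.2 le_rfl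
    rw [← opT_trunc D hle hαα, HS.eq_one (D.trunc _ hle) fun β hβ h0 => by
        rw [D.trunc_coeff hle hβ, h β (Coideal.mem_below.1 hβ) h0],
      opT_of_mem _ hαα, toU_rel (Rel.T_one p _ α hαα ?_), map_zero]
    exact Nat.pos_of_ne_zero fun h0 => hα ((Finsupp.degree_eq_zero_iff _).1 h0)
  · exact opT_of_notMem D hmem

/-- The components `D_β` with `β ≤ α` and `0 < |β| < l` are zero, that is `ℓ_α(D) ≥ l`. -/
def HS.VanishBelow {Δ : Coideal p} (D : HS k A Δ) (α : Fin p →₀ ℕ) (l : ℕ) : Prop :=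
  ∀ β ≤ α, β ≠ 0 → β.degree < l → D.coeff β = 0

theorem HS.VanishBelow.mono {Δ : Coideal p} {D : HS k A Δ} {α β : Fin p →₀ ℕ} {l : ℕ}
    (h : D.VanishBelow α l) (hβ : β ≤ α) : D.VanishBelow β l :=
  fun γ hγ => h γ (hγ.trans hβ)

theorem HS.vanishBelow_one {Δ : Coideal p} (D : HS k A Δ) (α : Fin p →₀ ℕ) :
    D.VanishBelow α 1 :=
  fun β _ h0 h => absurd ((Finsupp.degree_eq_zero_iff β).1 (by omega)) h0

theorem degree_pos {α : Fin p →₀ ℕ} (h : α ≠ 0) : 0 < α.degree :=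
  Nat.pos_of_ne_zero fun h0 => h ((Finsupp.degree_eq_zero_iff _).1 h0)

theorem HS.le_ell {Δ : Coideal p} {D : HS k A Δ} {α : Fin p →₀ ℕ} {l : ℕ}
    (h : D.VanishBelow α l) : (l : ℕ∞) ≤ D.ell α := by
  refine le_sInf ?_
  rintro r ⟨β, hβ, hd, hne, rfl⟩
  by_contra! hlt
  exact hne (h β hβ (fun h0 => by simp [h0] at hd) (by exact_mod_cast hlt))

theorem HS.coeff_eq_zero_of_lt_ell {Δ : Coideal p} {D : HS k A Δ} {α β : Fin p →₀ ℕ}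
    (hβ : β ≤ α) (h0 : β ≠ 0) (h : (β.degree : ℕ∞) < D.ell α) : D.coeff β = 0 := by
  by_contra hne
  exact absurd h (not_lt.2 (sInf_le ⟨β, hβ, degree_pos h0, hne, rfl⟩))

theorem Gen.deg_T_le_div {Δ : Coideal p} {D : HS k A Δ} {α : Fin p →₀ ℕ} (hα : α ∈ Δ) {l : ℕ}
    (hl : 1 ≤ l) (h : D.VanishBelow α l) : (Gen.T p Δ D α hα).deg ≤ α.degree / l := by
  rw [Gen.deg]
  split_ifs with ht
  · exact Nat.zero_le _
  · refine Nat.div_le_div_left ?_ hl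
    have := HS.le_ell h
    rwa [← ENat.natCast_toNat ht, Nat.cast_le] at this

theorem opT_mem {Δ : Coideal p} {D : HS k A Δ} {α : Fin p →₀ ℕ} {l : ℕ}
    (hl : 1 ≤ l) (h : D.VanishBelow α l) : opT D α ∈ (filU k A).F (α.degree / l) := by
  by_cases hα : α ∈ Δ
  · rw [opT_of_mem D hα]
    exact toU_mem (Gen.deg_T_le_div hα hl h)
  · rw [opT_of_notMem D hα]
    exact zero_mem _

theorem opT_mem_degree {Δ : Coideal p} (D : HS k A Δ) (α : Fin p →₀ ℕ) :
    opT D α ∈ (filU k A).F α.degree := by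
  have := opT_mem le_rfl (D.vanishBelow_one α)
  rwa [Nat.div_one] at this

theorem opS_mem (a : A) : opS k a ∈ (filU k A).F 0 :=
  toU_mem (x := Gen.S a) le_rfl

/-- Either `𝐓_{D,α}` is `0` or `1`, or its degree is `⌊|α| / l⌋` with `D` vanishing below `l`. -/
theorem Gen.deg_T_cases {Δ : Coideal p} (D : HS k A Δ) {α : Fin p →₀ ℕ} (hα : α ∈ Δ) :
    (opT D α = 0 ∨ opT D α = 1) ∨
      ∃ l, 1 ≤ l ∧ D.VanishBelow α l ∧ (Gen.T p Δ D α hα).deg = α.degree / l := by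
  by_cases ht : D.ell α = ⊤
  · left
    by_cases h0 : α = 0
    · right
      rw [h0, opT_zero]
    · left
      exact opT_eq_zero D h0 fun β hβ hβ0 =>
        HS.coeff_eq_zero_of_lt_ell hβ hβ0 (ht ▸ ENat.natCast_lt_top _)
  · right
    refine ⟨(D.ell α).toNat, ?_, fun β hβ hβ0 hlt => ?_, ?_⟩
    · have := HS.le_ell (D.vanishBelow_one α)
      rwa [← ENat.natCast_toNat ht, Nat.cast_le] at this
    · refine HS.coeff_eq_zero_of_lt_ell hβ hβ0 ?_
      rwa [← ENat.natCast_toNat ht, Nat.cast_lt]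
    · rw [Gen.deg, if_neg ht]

theorem AlgFiltration.mem_lt {R : Type*} [Ring R] [Algebra k R] (W : AlgFiltration k R) {i d : ℕ}
    {x : R} (hx : x ∈ W.F i) (h : i < d) : x ∈ W.lt d := by
  cases d with
  | zero => omega
  | succ d => exact W.mono (by omega) hx

/-! ### Pairs of multi-indices -/

/-- The additive equivalence `ℕ^p × ℕ^q ≃ ℕ^{p+q}`. -/
def pairEquiv (p q : ℕ) : (Fin p →₀ ℕ) × (Fin q →₀ ℕ) ≃+ (Fin (p + q) →₀ ℕ) :=
  Finsupp.sumFinsuppAddEquivProdFinsupp.symm.trans (Finsupp.domCongr finSumFinEquiv)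

theorem degree_pairEquiv (x : (Fin p →₀ ℕ) × (Fin q →₀ ℕ)) :
    (pairEquiv p q x).degree = x.1.degree + x.2.degree := by
  rw [Finsupp.degree_eq_sum, Finsupp.degree_eq_sum, Finsupp.degree_eq_sum, Fin.sum_univ_add]
  congr 1
  · refine Finset.sum_congr rfl fun i _ => ?_
    simp [pairEquiv]
  · refine Finset.sum_congr rfl fun i _ => ?_
    simp [pairEquiv]

theorem pairEquiv_le {x y : (Fin p →₀ ℕ) × (Fin q →₀ ℕ)} :
    pairEquiv p q x ≤ pairEquiv p q y ↔ x ≤ y := by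
  constructor
  · intro h
    obtain ⟨c, hc⟩ := exists_add_of_le h
    obtain ⟨c, rfl⟩ := (pairEquiv p q).surjective c
    rw [← map_add] at hc
    rw [(pairEquiv p q).injective hc]
    exact ⟨le_self_add, le_self_add⟩
  · intro h
    obtain ⟨c, hc⟩ := exists_add_of_le h.1
    obtain ⟨d, hd⟩ := exists_add_of_le h.2
    have : y = x + (c, d) := Prod.ext hc hd
    rw [this, map_add]
    exact le_self_add

/-! ### External products of Hasse--Schmidt derivations -/

/-- The product co-ideal `Δ × ∇` of `ℕ^{p+q}`. -/
def Coideal.prod (Δ : Coideal p) (Nb : Coideal q) : Coideal (p + q) where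
  carrier := {e | ((pairEquiv p q).symm e).1 ∈ Δ ∧ ((pairEquiv p q).symm e).2 ∈ Nb}
  nonempty := ⟨0, by rw [Set.mem_ofPred_eq, map_zero]; exact ⟨Δ.zero_mem, Nb.zero_mem⟩⟩
  lower := by
    intro e e' hle he
    have hle' : (pairEquiv p q).symm e' ≤ (pairEquiv p q).symm e := by
      rwa [← pairEquiv_le, AddEquiv.apply_symm_apply, AddEquiv.apply_symm_apply]
    exact ⟨Δ.mem_of_le hle'.1 he.1, Nb.mem_of_le hle'.2 he.2⟩

theorem Coideal.pair_mem_prod {Δ : Coideal p} {Nb : Coideal q} {a : Fin p →₀ ℕ}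
    {b : Fin q →₀ ℕ} : pairEquiv p q (a, b) ∈ Δ.prod Nb ↔ a ∈ Δ ∧ b ∈ Nb := by
  change ((pairEquiv p q).symm (pairEquiv p q (a, b))).1 ∈ Δ ∧
    ((pairEquiv p q).symm (pairEquiv p q (a, b))).2 ∈ Nb ↔ _
  rw [AddEquiv.symm_apply_apply]

variable (p q) in
/-- The inclusion of the first group of variables on the multi-indices. -/
def inlHom : (Fin p →₀ ℕ) →+ (Fin (p + q) →₀ ℕ) :=
  (pairEquiv p q).toAddMonoidHom.comp (AddMonoidHom.inl _ _)

variable (p q) in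
/-- The inclusion of the second group of variables on the multi-indices. -/
def inrHom : (Fin q →₀ ℕ) →+ (Fin (p + q) →₀ ℕ) :=
  (pairEquiv p q).toAddMonoidHom.comp (AddMonoidHom.inr _ _)

theorem inlHom_apply (a : Fin p →₀ ℕ) : inlHom p q a = pairEquiv p q (a, 0) := rfl

theorem inrHom_apply (b : Fin q →₀ ℕ) : inrHom p q b = pairEquiv p q (0, b) := rfl

theorem inlHom_injective : Function.Injective (inlHom p q) := fun _ _ h =>
  (Prod.ext_iff.1 ((pairEquiv p q).injective h)).1

theorem inrHom_injective : Function.Injective (inrHom p q) := fun _ _ h =>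
  (Prod.ext_iff.1 ((pairEquiv p q).injective h)).2

theorem degree_le_degree_inlHom (a : Fin p →₀ ℕ) : a.degree ≤ (inlHom p q a).degree := by
  rw [inlHom_apply, degree_pairEquiv]
  exact Nat.le_add_right _ _

theorem degree_le_degree_inrHom (b : Fin q →₀ ℕ) : b.degree ≤ (inrHom p q b).degree := by
  rw [inrHom_apply, degree_pairEquiv]
  exact Nat.le_add_left _ _

theorem Coideal.mem_of_inlHom_mem {Δ : Coideal p} {Nb : Coideal q} (a : Fin p →₀ ℕ)
    (h : inlHom p q a ∈ Δ.prod Nb) : a ∈ Δ :=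
  (Coideal.pair_mem_prod.1 h).1

theorem Coideal.mem_of_inrHom_mem {Δ : Coideal p} {Nb : Coideal q} (b : Fin q →₀ ℕ)
    (h : inrHom p q b ∈ Δ.prod Nb) : b ∈ Nb :=
  (Coideal.pair_mem_prod.1 h).2

/-- A Hasse--Schmidt derivation in the first group of variables. -/
def HS.inl {Δ : Coideal p} (Nb : Coideal q) (D : HS k A Δ) : HS k A (Δ.prod Nb) :=
  D.bullet (monomialSubst (inlHom p q) 1 degree_le_degree_inlHom Coideal.mem_of_inlHom_mem)

/-- A Hasse--Schmidt derivation in the second group of variables. -/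
def HS.inr (Δ : Coideal p) {Nb : Coideal q} (E : HS k A Nb) : HS k A (Δ.prod Nb) :=
  E.bullet (monomialSubst (inrHom p q) 1 degree_le_degree_inrHom Coideal.mem_of_inrHom_mem)

section Pair

variable {Δ : Coideal p} {Nb : Coideal q} (D : HS k A Δ) (E : HS k A Nb)

theorem HS.inl_coeff {a : Fin p →₀ ℕ} (ha : a ∈ Δ) :
    (D.inl Nb).coeff (pairEquiv p q (a, 0)) = D.coeff a := by
  have := bullet_monomialSubst_coeff _ 1 degree_le_degree_inlHom Coideal.mem_of_inlHom_mem D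
    inlHom_injective (Coideal.pair_mem_prod.2 ⟨ha, Nb.zero_mem⟩)
  rwa [one_pow, one_smul] at this

theorem HS.inr_coeff {b : Fin q →₀ ℕ} (hb : b ∈ Nb) :
    (E.inr Δ).coeff (pairEquiv p q (0, b)) = E.coeff b := by
  have := bullet_monomialSubst_coeff _ 1 degree_le_degree_inrHom Coideal.mem_of_inrHom_mem E
    inrHom_injective (Coideal.pair_mem_prod.2 ⟨Δ.zero_mem, hb⟩)
  rwa [one_pow, one_smul] at this

theorem opT_inl {a : Fin p →₀ ℕ} (ha : a ∈ Δ) :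
    opT (D.inl Nb) (pairEquiv p q (a, 0)) = opT D a := by
  have := opT_bullet_monomialSubst _ 1 degree_le_degree_inlHom Coideal.mem_of_inlHom_mem D
    inlHom_injective (Coideal.pair_mem_prod.2 ⟨ha, Nb.zero_mem⟩)
  rwa [one_pow, map_one, one_mul] at this

theorem opT_inr {b : Fin q →₀ ℕ} (hb : b ∈ Nb) :
    opT (E.inr Δ) (pairEquiv p q (0, b)) = opT E b := by
  have := opT_bullet_monomialSubst _ 1 degree_le_degree_inrHom Coideal.mem_of_inrHom_mem E
    inrHom_injective (Coideal.pair_mem_prod.2 ⟨Δ.zero_mem, hb⟩)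
  rwa [one_pow, map_one, one_mul] at this

theorem ne_inl_of_ne_zero {a : Fin p →₀ ℕ} {b : Fin q →₀ ℕ} (hb : b ≠ 0) (α : Fin p →₀ ℕ) :
    pairEquiv p q (a, b) ≠ inlHom p q α := fun h =>
  hb (Prod.ext_iff.1 ((pairEquiv p q).injective h)).2

theorem ne_inr_of_ne_zero {a : Fin p →₀ ℕ} {b : Fin q →₀ ℕ} (ha : a ≠ 0) (β : Fin q →₀ ℕ) :
    pairEquiv p q (a, b) ≠ inrHom p q β := fun h =>
  ha (Prod.ext_iff.1 ((pairEquiv p q).injective h)).1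

/-- In the sum over the decompositions of `(a, b)` only `(a, 0) + (0, b)` contributes, if `f`
vanishes unless its first argument is of the form `(c, 0)` and its second one of the form `(0, d)`. -/
theorem sum_antidiagonal_pair {M : Type*} [AddCommMonoid M] (a : Fin p →₀ ℕ) (b : Fin q →₀ ℕ)
    (f : (Fin (p + q) →₀ ℕ) × (Fin (p + q) →₀ ℕ) → M)
    (h1 : ∀ c d y, d ≠ 0 → f (pairEquiv p q (c, d), y) = 0)
    (h2 : ∀ c d x, c ≠ 0 → f (x, pairEquiv p q (c, d)) = 0) :
    ∑ x ∈ antidiagonal (pairEquiv p q (a, b)), f x =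
      f (pairEquiv p q (a, 0), pairEquiv p q (0, b)) := by
  refine Finset.sum_eq_single _ ?_ ?_
  · rintro ⟨x, y⟩ hxy hne
    obtain ⟨⟨c, d⟩, rfl⟩ := (pairEquiv p q).surjective x
    obtain ⟨⟨c', d'⟩, rfl⟩ := (pairEquiv p q).surjective y
    have h := mem_antidiagonal.1 hxy
    rw [← map_add] at h
    have h' := Prod.ext_iff.1 ((pairEquiv p q).injective h)
    by_cases hd : d = 0
    · by_cases hc : c' = 0
      · subst hd hc
        simp only [Prod.fst_add, Prod.snd_add, add_zero, zero_add] at h'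
        exact absurd (by rw [h'.1, h'.2]) hne
      · exact h2 _ _ _ hc
    · exact h1 _ _ _ hd
  · intro h
    refine absurd (mem_antidiagonal.2 ?_) h
    rw [← map_add, Prod.mk_add_mk, add_zero, zero_add]

theorem sum_antidiagonal_pair' {M : Type*} [AddCommMonoid M] (a : Fin p →₀ ℕ) (b : Fin q →₀ ℕ)
    (f : (Fin (p + q) →₀ ℕ) × (Fin (p + q) →₀ ℕ) → M)
    (h1 : ∀ c d y, c ≠ 0 → f (pairEquiv p q (c, d), y) = 0)
    (h2 : ∀ c d x, d ≠ 0 → f (x, pairEquiv p q (c, d)) = 0) :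
    ∑ x ∈ antidiagonal (pairEquiv p q (a, b)), f x =
      f (pairEquiv p q (0, b), pairEquiv p q (a, 0)) := by
  refine Eq.trans (Finset.sum_nbij' Prod.swap Prod.swap ?_ ?_ (fun _ _ => rfl) (fun _ _ => rfl)
    (fun _ _ => rfl)) ?_ (b := ∑ x ∈ antidiagonal (pairEquiv p q (a, b)), f x.swap)
  · intro x hx
    exact mem_antidiagonal.2 ((add_comm _ _).trans (mem_antidiagonal.1 hx))
  · intro x hx
    exact mem_antidiagonal.2 ((add_comm _ _).trans (mem_antidiagonal.1 hx))
  exact sum_antidiagonal_pair a b (fun x => f x.swap) (fun c d y h => h2 c d y h)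
    (fun c d x h => h1 c d x h)

theorem HS.inl_comp_inr_coeff {a : Fin p →₀ ℕ} {b : Fin q →₀ ℕ} (ha : a ∈ Δ) (hb : b ∈ Nb) :
    ((D.inl Nb).comp (E.inr Δ)).coeff (pairEquiv p q (a, b)) = D.coeff a ∘ₗ E.coeff b := by
  rw [HS.comp_coeff _ _ (Coideal.pair_mem_prod.2 ⟨ha, hb⟩), sum_antidiagonal_pair,
    HS.inl_coeff D ha, HS.inr_coeff E hb]
  · intro c d y hd
    rw [HS.inl, bullet_monomialSubst_coeff_eq_zero _ _ _ _ _ (ne_inl_of_ne_zero hd),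
      LinearMap.zero_comp]
  · intro c d y hd
    rw [HS.inr, bullet_monomialSubst_coeff_eq_zero _ _ _ _ _ (ne_inr_of_ne_zero hd),
      LinearMap.comp_zero]

theorem HS.inr_comp_inl_coeff {a : Fin p →₀ ℕ} {b : Fin q →₀ ℕ} (ha : a ∈ Δ) (hb : b ∈ Nb) :
    ((E.inr Δ).comp (D.inl Nb)).coeff (pairEquiv p q (a, b)) = E.coeff b ∘ₗ D.coeff a := by
  rw [HS.comp_coeff _ _ (Coideal.pair_mem_prod.2 ⟨ha, hb⟩), sum_antidiagonal_pair',
    HS.inl_coeff D ha, HS.inr_coeff E hb]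
  · intro c d y hd
    rw [HS.inr, bullet_monomialSubst_coeff_eq_zero _ _ _ _ _ (ne_inr_of_ne_zero hd),
      LinearMap.zero_comp]
  · intro c d y hd
    rw [HS.inl, bullet_monomialSubst_coeff_eq_zero _ _ _ _ _ (ne_inl_of_ne_zero hd),
      LinearMap.comp_zero]

theorem opT_inl_comp_inr {a : Fin p →₀ ℕ} {b : Fin q →₀ ℕ} (ha : a ∈ Δ) (hb : b ∈ Nb) :
    opT ((D.inl Nb).comp (E.inr Δ)) (pairEquiv p q (a, b)) = opT D a * opT E b := by
  rw [opT_comp _ _ (Coideal.pair_mem_prod.2 ⟨ha, hb⟩), sum_antidiagonal_pair,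
    opT_inl D ha, opT_inr E hb]
  · intro c d y hd
    rw [HS.inl, opT_bullet_monomialSubst_eq_zero _ _ _ _ _ (ne_inl_of_ne_zero hd), zero_mul]
  · intro c d y hd
    rw [HS.inr, opT_bullet_monomialSubst_eq_zero _ _ _ _ _ (ne_inr_of_ne_zero hd), mul_zero]

theorem opT_inr_comp_inl {a : Fin p →₀ ℕ} {b : Fin q →₀ ℕ} (ha : a ∈ Δ) (hb : b ∈ Nb) :
    opT ((E.inr Δ).comp (D.inl Nb)) (pairEquiv p q (a, b)) = opT E b * opT D a := by
  rw [opT_comp _ _ (Coideal.pair_mem_prod.2 ⟨ha, hb⟩), sum_antidiagonal_pair',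
    opT_inl D ha, opT_inr E hb]
  · intro c d y hd
    rw [HS.inr, opT_bullet_monomialSubst_eq_zero _ _ _ _ _ (ne_inr_of_ne_zero hd), zero_mul]
  · intro c d y hd
    rw [HS.inl, opT_bullet_monomialSubst_eq_zero _ _ _ _ _ (ne_inl_of_ne_zero hd), mul_zero]

end Pair

/-! ### Commutators of the generators -/

/-- The difference `𝐓_{H,α} - 𝐓_{G,α}` in terms of the quotient `H ∘ G⁻¹`. -/
theorem opT_sub_eq_sum {Δ : Coideal p} (H G : HS k A Δ) {α : Fin p →₀ ℕ} (hα : α ∈ Δ) :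
    opT H α - opT G α =
      ∑ x ∈ (antidiagonal α).erase (0, α), opT (H.div G) x.1 * opT G x.2 := by
  have h : opT H α = opT ((H.div G).comp G) α := by rw [HS.div_comp]
  rw [h, opT_comp _ _ hα, ← Finset.add_sum_erase _ _ (show (0, α) ∈ antidiagonal α by simp),
    opT_zero, one_mul, add_sub_cancel_left]

theorem fst_ne_zero_of_mem_erase {α : Fin p →₀ ℕ} {x : (Fin p →₀ ℕ) × (Fin p →₀ ℕ)}
    (hx : x ∈ (antidiagonal α).erase (0, α)) : x.1 ≠ 0 := by
  intro h
  refine Finset.ne_of_mem_erase hx (Prod.ext h ?_)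
  rw [← mem_antidiagonal.1 (Finset.mem_of_mem_erase hx), h, zero_add]

theorem div_add_div_lt {x y l m : ℕ} (hl : 1 ≤ l) (hm : 1 ≤ m) (hx : l ≤ x) (hy : m ≤ y) :
    (x + y) / (l + m) < x / l + y / m := by
  have hf : 1 ≤ x / l := (Nat.one_le_div_iff hl).2 hx
  have hg : 1 ≤ y / m := (Nat.one_le_div_iff hm).2 hy
  have h1 : x < l * (x / l + 1) := Nat.lt_mul_div_succ x hl
  have h2 : y < m * (y / m + 1) := Nat.lt_mul_div_succ y hm
  rw [Nat.div_lt_iff_lt_mul (by omega)]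
  have h3 : l * (x / l + 1) ≤ l * (x / l + y / m) := Nat.mul_le_mul_left _ (by omega)
  have h4 : m * (y / m + 1) ≤ m * (x / l + y / m) := Nat.mul_le_mul_left _ (by omega)
  calc x + y < l * (x / l + y / m) + m * (x / l + y / m) := by omega
    _ = (x / l + y / m) * (l + m) := by ring

/-- The commutator of `𝐓_{D,α}` and `𝐓_{E,β}` has degree smaller than expected: in the group of
Hasse--Schmidt derivations in the two groups of variables, the commutator of `D` and `E` is trivial
at each index `(a, b)` with `|a| < l` or `|b| < m`. -/
theorem opT_mul_opT_sub_mem {Δ : Coideal p} {Nb : Coideal q} {D : HS k A Δ} {E : HS k A Nb}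
    {α : Fin p →₀ ℕ} {β : Fin q →₀ ℕ} (hα : α ∈ Δ) (hβ : β ∈ Nb) {l m : ℕ} (hl : 1 ≤ l)
    (hm : 1 ≤ m) (hD : D.VanishBelow α l) (hE : E.VanishBelow β m) :
    opT D α * opT E β - opT E β * opT D α ∈ (filU k A).lt (α.degree / l + β.degree / m) := by
  rw [← opT_inl_comp_inr D E hα hβ, ← opT_inr_comp_inl D E hα hβ,
    opT_sub_eq_sum _ _ (Coideal.pair_mem_prod.2 ⟨hα, hβ⟩)]
  set K := ((D.inl Nb).comp (E.inr Δ)).div ((E.inr Δ).comp (D.inl Nb)) with hK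
  have hvan : ∀ a ≤ α, ∀ b ≤ β, (a, b) ≠ 0 → (a.degree < l ∨ b.degree < m) →
      K.coeff (pairEquiv p q (a, b)) = 0 := by
    intro a ha b hb hne hab
    refine HS.div_coeff_eq_zero _ _
      (Coideal.pair_mem_prod.2 ⟨Δ.mem_of_le ha hα, Nb.mem_of_le hb hβ⟩)
      (fun h => hne ((pairEquiv p q).injective (h.trans (map_zero _).symm))) ?_
    intro e he
    obtain ⟨⟨c, d⟩, rfl⟩ := (pairEquiv p q).surjective e
    obtain ⟨hc, hd⟩ : c ≤ a ∧ d ≤ b := pairEquiv_le.1 he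
    have hcα := hc.trans ha
    have hdβ := hd.trans hb
    rw [HS.inl_comp_inr_coeff D E (Δ.mem_of_le hcα hα) (Nb.mem_of_le hdβ hβ),
      HS.inr_comp_inl_coeff D E (Δ.mem_of_le hcα hα) (Nb.mem_of_le hdβ hβ)]
    rcases hab with h | h
    · by_cases hc0 : c = 0
      · rw [hc0, D.coeff_zero, LinearMap.id_comp, LinearMap.comp_id]
      · rw [hD c hcα hc0 ((Finsupp.degree_mono hc).trans_lt h), LinearMap.zero_comp,
          LinearMap.comp_zero]
    · by_cases hd0 : d = 0
      · rw [hd0, E.coeff_zero, LinearMap.id_comp, LinearMap.comp_id]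
      · rw [hE d hdβ hd0 ((Finsupp.degree_mono hd).trans_lt h), LinearMap.zero_comp,
          LinearMap.comp_zero]
  refine Submodule.sum_mem _ fun x hx => ?_
  have hx0 := fst_ne_zero_of_mem_erase hx
  have hx' := mem_antidiagonal.1 (Finset.mem_of_mem_erase hx)
  obtain ⟨x, y⟩ := x
  obtain ⟨⟨a, b⟩, rfl⟩ := (pairEquiv p q).surjective x
  obtain ⟨⟨a', b'⟩, rfl⟩ := (pairEquiv p q).surjective y
  rw [← map_add] at hx'
  obtain ⟨h1, h2⟩ := Prod.ext_iff.1 ((pairEquiv p q).injective hx')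
  simp only [Prod.fst_add, Prod.snd_add] at h1 h2 hx0 ⊢
  have haα : a ≤ α := h1 ▸ le_self_add
  have hbβ : b ≤ β := h2 ▸ le_self_add
  have haα' : a' ≤ α := h1 ▸ le_add_self
  have hbβ' : b' ≤ β := h2 ▸ le_add_self
  by_cases hab : a.degree < l ∨ b.degree < m
  · rw [opT_eq_zero K hx0, zero_mul]
    · exact zero_mem _
    · intro e he he0
      obtain ⟨⟨c, d⟩, rfl⟩ := (pairEquiv p q).surjective e
      obtain ⟨hc, hd⟩ : c ≤ a ∧ d ≤ b := pairEquiv_le.1 he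
      refine hvan c (hc.trans haα) d (hd.trans hbβ) (fun h => he0 (by rw [h, map_zero])) ?_
      exact hab.imp (Finsupp.degree_mono hc).trans_lt (Finsupp.degree_mono hd).trans_lt
  · push Not at hab
    have hKmem : opT K (pairEquiv p q (a, b)) ∈
        (filU k A).F ((pairEquiv p q (a, b)).degree / (l + m)) := by
      refine opT_mem (by omega) ?_
      intro e he he0 hdeg
      obtain ⟨⟨c, d⟩, rfl⟩ := (pairEquiv p q).surjective e
      obtain ⟨hc, hd⟩ : c ≤ a ∧ d ≤ b := pairEquiv_le.1 he
      refine hvan c (hc.trans haα) d (hd.trans hbβ) (fun h => he0 (by rw [h, map_zero])) ?_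
      rw [degree_pairEquiv] at hdeg
      by_contra! hcd
      simp only at hdeg
      omega
    rw [degree_pairEquiv] at hKmem
    rw [opT_inr_comp_inl D E (Δ.mem_of_le haα' hα) (Nb.mem_of_le hbβ' hβ)]
    refine (filU k A).mem_lt ((filU k A).mul_mem hKmem ((filU k A).mul_mem
      (opT_mem hm (hE.mono hbβ')) (opT_mem hl (hD.mono haα')))) ?_
    have hlt := div_add_div_lt hl hm hab.1 hab.2
    have e1 : a.degree / l + a'.degree / l ≤ α.degree / l := by
      rw [← h1, map_add]
      exact Nat.div_add_div_le_add_div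
    have e2 : b.degree / m + b'.degree / m ≤ β.degree / m := by
      rw [← h2, map_add]
      exact Nat.div_add_div_le_add_div
    simp only
    omega

theorem opT_mul_opS_sub_mem {Δ : Coideal p} {D : HS k A Δ} {α : Fin p →₀ ℕ} (hα : α ∈ Δ) {l : ℕ}
    (hl : 1 ≤ l) (hD : D.VanishBelow α l) (a : A) :
    opT D α * opS k a - opS k a * opT D α ∈ (filU k A).lt (α.degree / l) := by
  rw [opT_mul_opS D hα, ← Finset.add_sum_erase _ _ (show (0, α) ∈ antidiagonal α by simp),
    D.coeff_zero, LinearMap.id_apply, add_sub_cancel_left]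
  refine Submodule.sum_mem _ fun x hx => ?_
  have hx0 := fst_ne_zero_of_mem_erase hx
  have hx' := mem_antidiagonal.1 (Finset.mem_of_mem_erase hx)
  have h1 : x.1 ≤ α := hx' ▸ le_self_add
  have h2 : x.2 ≤ α := hx' ▸ le_add_self
  by_cases hlt : x.1.degree < l
  · rw [hD _ h1 hx0 hlt, LinearMap.zero_apply, map_zero, zero_mul]
    exact zero_mem _
  · refine (filU k A).mem_lt ((filU k A).mul_mem (opS_mem _) (opT_mem hl (hD.mono h2))) ?_
    rw [zero_add, ← hx', map_add]
    have e1 : x.1.degree / l + x.2.degree / l ≤ (x.1.degree + x.2.degree) / l :=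
      Nat.div_add_div_le_add_div
    have e2 : 1 ≤ x.1.degree / l := (Nat.one_le_div_iff hl).2 (not_lt.1 hlt)
    omega

theorem toU_gen_commutator_mem (x y : Gen k A) :
    toU k A (FreeAlgebra.ι k x) * toU k A (FreeAlgebra.ι k y) -
      toU k A (FreeAlgebra.ι k y) * toU k A (FreeAlgebra.ι k x) ∈
        (filU k A).lt (x.deg + y.deg) := by
  -- the generators equal to `0` or `1` are central
  have htriv : ∀ u v : U k A, (u = 0 ∨ u = 1) → ∀ d, u * v - v * u ∈ (filU k A).lt d ∧
      v * u - u * v ∈ (filU k A).lt d := by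
    rintro u v (rfl | rfl) d <;> simp
  rcases x with a | ⟨p, Δ, D, α, hα⟩ <;> rcases y with b | ⟨q, Nb, E, β, hβ⟩
  · change opS k a * opS k b - opS k b * opS k a ∈ _
    rw [← map_mul, ← map_mul, mul_comm, sub_self]
    exact zero_mem _
  · change opS k a * toU k A (varT E β hβ) - toU k A (varT E β hβ) * opS k a ∈ _
    rw [← opT_of_mem]
    rcases Gen.deg_T_cases E hβ with h | ⟨m, hm, hE, hdeg⟩
    · exact (htriv _ _ h _).2
    · rw [hdeg, ← neg_sub, neg_mem_iff]
      exact (zero_add (β.degree / m)).symm ▸ opT_mul_opS_sub_mem hβ hm hE a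
  · change toU k A (varT D α hα) * opS k b - opS k b * toU k A (varT D α hα) ∈ _
    rw [← opT_of_mem]
    rcases Gen.deg_T_cases D hα with h | ⟨l, hl, hD, hdeg⟩
    · exact (htriv _ _ h _).1
    · rw [hdeg]
      exact opT_mul_opS_sub_mem hα hl hD b
  · change toU k A (varT D α hα) * toU k A (varT E β hβ) -
      toU k A (varT E β hβ) * toU k A (varT D α hα) ∈ _
    rw [← opT_of_mem, ← opT_of_mem]
    rcases Gen.deg_T_cases D hα with h | ⟨l, hl, hD, hdeg⟩
    · exact (htriv _ _ h _).1
    rcases Gen.deg_T_cases E hβ with h | ⟨m, hm, hE, hdeg'⟩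
    · exact (htriv _ _ h _).2
    rw [hdeg, hdeg']
    exact opT_mul_opT_sub_mem hα hβ hl hm hD hE

/-! ### Commutativity of the graded ring -/

theorem toU_prod_mem (l : List (Gen k A)) :
    toU k A (l.map (FreeAlgebra.ι k)).prod ∈ (filU k A).F (l.map Gen.deg).sum :=
  ⟨_, Submodule.subset_span ⟨l, le_rfl, rfl⟩, rfl⟩

theorem AlgFiltration.lt_mono {R : Type*} [Ring R] [Algebra k R] (W : AlgFiltration k R) :
    Monotone W.lt := by
  intro i j h x hx
  cases i with
  | zero =>
    rw [(Submodule.mem_bot k).1 hx]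
    exact zero_mem _
  | succ i => exact W.mem_lt hx (by omega)

theorem toU_gen_list_commutator_mem (x : Gen k A) (l : List (Gen k A)) :
    toU k A (FreeAlgebra.ι k x) * toU k A (l.map (FreeAlgebra.ι k)).prod -
      toU k A (l.map (FreeAlgebra.ι k)).prod * toU k A (FreeAlgebra.ι k x) ∈
        (filU k A).lt (x.deg + (l.map Gen.deg).sum) := by
  induction l with
  | nil => simp
  | cons y l ih =>
    simp only [List.map_cons, List.prod_cons, map_mul, List.sum_cons]
    set X := toU k A (FreeAlgebra.ι k x)
    set Y := toU k A (FreeAlgebra.ι k y) with hY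
    set L := toU k A (l.map (FreeAlgebra.ι k)).prod
    have h : X * (Y * L) - Y * L * X = (X * Y - Y * X) * L + Y * (X * L - L * X) := by
      noncomm_ring
    rw [h]
    refine add_mem ?_ ?_
    · rw [← add_assoc]
      exact (filU k A).lt_mul (toU_gen_commutator_mem x y) (toU_prod_mem l)
    · rw [add_left_comm]
      exact (filU k A).mul_lt (toU_mem le_rfl) ih

theorem toU_list_commutator_mem (l l' : List (Gen k A)) :
    toU k A (l.map (FreeAlgebra.ι k)).prod * toU k A (l'.map (FreeAlgebra.ι k)).prod -
      toU k A (l'.map (FreeAlgebra.ι k)).prod * toU k A (l.map (FreeAlgebra.ι k)).prod ∈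
        (filU k A).lt ((l.map Gen.deg).sum + (l'.map Gen.deg).sum) := by
  induction l with
  | nil => simp
  | cons y l ih =>
    simp only [List.map_cons, List.prod_cons, map_mul, List.sum_cons]
    set X := toU k A (l'.map (FreeAlgebra.ι k)).prod
    set Y := toU k A (FreeAlgebra.ι k y) with hY
    set L := toU k A (l.map (FreeAlgebra.ι k)).prod
    have h : Y * L * X - X * (Y * L) = Y * (L * X - X * L) + (Y * X - X * Y) * L := by
      noncomm_ring
    rw [h]
    refine add_mem ?_ ?_
    · rw [add_assoc]
      exact (filU k A).mul_lt (toU_mem le_rfl) ih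
    · rw [add_right_comm]
      exact (filU k A).lt_mul (toU_gen_list_commutator_mem y l') (toU_prod_mem l)

theorem mem_filU_induction {d : ℕ} {P : U k A → Prop}
    (h : ∀ l : List (Gen k A), (l.map Gen.deg).sum ≤ d →
      P (toU k A (l.map (FreeAlgebra.ι k)).prod))
    (hzero : P 0) (hadd : ∀ x y, P x → P y → P (x + y)) (hsmul : ∀ (c : k) x, P x → P (c • x))
    {x : U k A} (hx : x ∈ (filU k A).F d) : P x := by
  obtain ⟨x, hx, rfl⟩ := hx
  change P (toU k A x)
  induction hx using Submodule.span_induction with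
  | mem x hx =>
    obtain ⟨l, hl, rfl⟩ := hx
    exact h l hl
  | zero => rwa [map_zero]
  | add x y _ _ hx hy => rw [map_add]; exact hadd _ _ hx hy
  | smul c x _ hx => rw [map_smul]; exact hsmul _ _ hx

theorem commutator_mem {i j : ℕ} {x y : U k A} (hx : x ∈ (filU k A).F i)
    (hy : y ∈ (filU k A).F j) : x * y - y * x ∈ (filU k A).lt (i + j) := by
  refine mem_filU_induction (P := fun x => x * y - y * x ∈ (filU k A).lt (i + j)) ?_ ?_ ?_ ?_ hx
  · intro l hl
    refine mem_filU_induction (P := fun y => toU k A (l.map (FreeAlgebra.ι k)).prod * y -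
      y * toU k A (l.map (FreeAlgebra.ι k)).prod ∈ (filU k A).lt (i + j)) ?_ ?_ ?_ ?_ hy
    · intro l' hl'
      exact (filU k A).lt_mono (add_le_add hl hl') (toU_list_commutator_mem l l')
    · simp
    · intro x y hx hy
      rw [mul_add, add_mul, add_sub_add_comm]
      exact add_mem hx hy
    · intro c x hx
      rw [mul_smul_comm, smul_mul_assoc, ← smul_sub]
      exact Submodule.smul_mem _ c hx
  · simp
  · intro x y hx hy
    rw [mul_add, add_mul, add_sub_add_comm]
    exact add_mem hx hy
  · intro c x hx
    rw [mul_smul_comm, smul_mul_assoc, ← smul_sub]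
    exact Submodule.smul_mem _ c hx

namespace AlgFiltration

variable {R : Type*} [Ring R] [Algebra k R] (W : AlgFiltration k R)

theorem symbol_mul {i j : ℕ} {x y : R} (hx : x ∈ W.F i) (hy : y ∈ W.F j) :
    W.symbol i x hx * W.symbol j y hy = W.symbol (i + j) (x * y) (W.mul_mem hx hy) :=

  -- the product of the pieces is not found by instance search here
  @DirectSum.of_mul_of ℕ _ W.piece _ _ W.gring.toGSemiring.toGNonUnitalNonAssocSemiring _ _ _ _

theorem symbol_add {i : ℕ} {x y : R} (hx : x ∈ W.F i) (hy : y ∈ W.F i) :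
    W.symbol i (x + y) (add_mem hx hy) = W.symbol i x hx + W.symbol i y hy :=
  (map_add (DirectSum.of W.piece i) (W.cls i ⟨x, hx⟩) (W.cls i ⟨y, hy⟩)).symm ▸ rfl

theorem symbol_one : W.symbol 0 1 W.one_mem = 1 :=
  rfl

theorem symbol_eq_of_sub_mem {i : ℕ} {x y : R} (hx : x ∈ W.F i) (hy : y ∈ W.F i)
    (h : x - y ∈ W.lt i) : W.symbol i x hx = W.symbol i y hy := by
  refine congrArg (DirectSum.of W.piece i) ?_
  exact (Submodule.Quotient.eq _).2 h

theorem symbol_congr {i j : ℕ} (hij : i = j) {x y : R} (hxy : x = y) (hx : x ∈ W.F i) :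
    W.symbol i x hx = W.symbol j y (hij ▸ hxy ▸ hx) := by
  subst hij hxy
  rfl

theorem gr_induction {P : W.Gr → Prop} (hzero : P 0) (hadd : ∀ x y, P x → P y → P (x + y))
    (h : ∀ i x hx, P (W.symbol i x hx)) (x : W.Gr) : P x := by
  refine DirectSum.induction_on (motive := P) x hzero (fun i x => ?_) hadd
  obtain ⟨⟨x, hx⟩, rfl⟩ := Submodule.mkQ_surjective _ x
  exact h i x hx

end AlgFiltration

variable (k A) in
/-- The graded ring `gr 𝕌_{A/k}` as a commutative ring. This is not an instance, so that there is
only one path to the ring structure. -/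
abbrev grUCommRing : CommRing (GrU k A) where
  mul_comm x y := by
    refine (filU k A).gr_induction (P := fun x => x * y = y * x) ?_ ?_ ?_ x
    · rw [zero_mul, mul_zero]
    · intro x x' hx hx'
      rw [add_mul, mul_add, hx, hx']
    · intro i x hx
      refine (filU k A).gr_induction (P := fun y => _ * y = y * _) ?_ ?_ ?_ y
      · rw [zero_mul, mul_zero]
      · intro x x' hx hx'
        rw [add_mul, mul_add, hx, hx']
      · intro j y hy
        rw [AlgFiltration.symbol_mul, AlgFiltration.symbol_mul,
          (filU k A).symbol_congr (add_comm j i) rfl]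
        exact (filU k A).symbol_eq_of_sub_mem _ _ (commutator_mem hx hy)

/-! ### Symbols -/

/-- `x` lies in `F_n` and its symbol in degree `n` is `g`. -/
def AlgFiltration.HasSymbol {R : Type*} [Ring R] [Algebra k R] (W : AlgFiltration k R) (n : ℕ)
    (x : R) (g : W.Gr) : Prop :=
  ∃ hx : x ∈ W.F n, W.symbol n x hx = g

namespace AlgFiltration.HasSymbol

variable {R : Type*} [Ring R] [Algebra k R] {W : AlgFiltration k R} {n m : ℕ} {x y : R}
  {g h : W.Gr}

theorem unique (hx : W.HasSymbol n x g) (hx' : W.HasSymbol n x h) : g = h := by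
  obtain ⟨_, rfl⟩ := hx
  obtain ⟨_, rfl⟩ := hx'
  rfl

theorem add (hx : W.HasSymbol n x g) (hy : W.HasSymbol n y h) : W.HasSymbol n (x + y) (g + h) := by
  obtain ⟨hx, rfl⟩ := hx
  obtain ⟨hy, rfl⟩ := hy
  exact ⟨add_mem hx hy, W.symbol_add hx hy⟩

theorem mul (hx : W.HasSymbol n x g) (hy : W.HasSymbol m y h) :
    W.HasSymbol (n + m) (x * y) (g * h) := by
  obtain ⟨hx, rfl⟩ := hx
  obtain ⟨hy, rfl⟩ := hy
  exact ⟨W.mul_mem hx hy, (W.symbol_mul hx hy).symm⟩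

theorem of_mem_lt (hx : x ∈ W.lt n) (hn : x ∈ W.F n) : W.HasSymbol n x 0 := by
  refine ⟨hn, ?_⟩
  rw [AlgFiltration.symbol, W.cls_eq_zero hx, map_zero]
  rfl

theorem of_sub_mem (hx : W.HasSymbol n x g) (hy : y ∈ W.F n) (hsub : y - x ∈ W.lt n) :
    W.HasSymbol n y g := by
  obtain ⟨hx, rfl⟩ := hx
  exact ⟨hy, W.symbol_eq_of_sub_mem hy hx hsub⟩

theorem sum {ι : Type*} {s : Finset ι} {f : ι → R} {g : ι → W.Gr}
    (hf : ∀ i ∈ s, W.HasSymbol n (f i) (g i)) :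
    W.HasSymbol n (∑ i ∈ s, f i) (∑ i ∈ s, g i) := by
  classical
  induction s using Finset.induction_on with
  | empty => exact of_mem_lt (zero_mem _) (zero_mem _)
  | insert i s hi ih =>
    rw [Finset.sum_insert hi, Finset.sum_insert hi]
    exact (hf i (Finset.mem_insert_self _ _)).add
      (ih fun j hj => hf j (Finset.mem_insert_of_mem hj))

end AlgFiltration.HasSymbol

theorem hasSymbol_symS (a : A) : (filU k A).HasSymbol 0 (opS k a) (symS k a) :=
  ⟨opS_mem a, rfl⟩

theorem symS_one : symS k (1 : A) = 1 :=
  (filU k A).symbol_congr rfl (map_one (opS k)) _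

theorem symS_zero : symS k (0 : A) = 0 :=
  (hasSymbol_symS 0).unique ((map_zero (opS k (A := A))).symm ▸
    AlgFiltration.HasSymbol.of_mem_lt (zero_mem _) (zero_mem _))

theorem symS_mul (a b : A) : symS k (a * b) = symS k a * symS k b := by
  have h := (hasSymbol_symS (k := k) a).mul (hasSymbol_symS b)
  rw [← map_mul, add_zero] at h
  exact (hasSymbol_symS (a * b)).unique h

theorem symS_add (a b : A) : symS k (a + b) = symS k a + symS k b :=
  (hasSymbol_symS (a + b)).unique ((map_add (opS k) a b).symm ▸
    (hasSymbol_symS a).add (hasSymbol_symS b))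

variable (k A) in
/-- The map `A → gr 𝕌_{A/k}`, `a ↦ σ_0(𝐒_a)`, as a ring homomorphism. -/
def symSHom : A →+* GrU k A where
  toFun := symS k
  map_one' := symS_one
  map_mul' := symS_mul
  map_zero' := symS_zero
  map_add' := symS_add

/-! ### Symbols of integrals of a derivation -/

/-- Two Hasse--Schmidt derivations with the same components of order one define operators with the
same symbol: their quotient vanishes below degree two. -/
theorem opT_sub_mem_of_agree {Δ : Coideal p} (H G : HS k A Δ) {α : Fin p →₀ ℕ} (hα : α ∈ Δ)
    (h : ∀ β ≤ α, β.degree ≤ 1 → H.coeff β = G.coeff β) :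
    opT H α - opT G α ∈ (filU k A).lt α.degree := by
  rw [opT_sub_eq_sum H G hα]
  refine Submodule.sum_mem _ fun x hx => ?_
  have hx0 := degree_pos (fst_ne_zero_of_mem_erase hx)
  have hx' := mem_antidiagonal.1 (Finset.mem_of_mem_erase hx)
  have hle : x.1 ≤ α := hx' ▸ le_self_add
  have hvan : (H.div G).VanishBelow x.1 2 := fun β hβ hβ0 hdeg =>
    HS.div_coeff_eq_zero H G (Δ.mem_of_le (hβ.trans hle) hα) hβ0 fun γ hγ =>
      h γ (hγ.trans (hβ.trans hle)) ((Finsupp.degree_mono hγ).trans (by omega))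
  refine (filU k A).mem_lt ((filU k A).mul_mem (opT_mem (by omega) hvan) (opT_mem_degree G _)) ?_
  rw [← hx', map_add]
  omega

theorem idx_zero : idx 0 = 0 :=
  Finsupp.single_zero _

theorem eq_idx (β : Fin 1 →₀ ℕ) : β = idx β.degree := by
  rw [Finsupp.unique_single β, Finsupp.degree_single]
  rfl

/-- `D` is an `m`-integral of `δ`; for `m = 0` there is no condition. -/
def HS.Integrates {m : ℕ} (D : HS k A (Coideal.tot 1 m)) (δ : Derivation k A A) : Prop :=
  1 ≤ m → D.coeff (idx 1) = δ.toLinearMap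

theorem HS.Integrates.coeff_eq {m n : ℕ} {D : HS k A (Coideal.tot 1 m)}
    {E : HS k A (Coideal.tot 1 n)} {δ : Derivation k A A} (hD : D.Integrates δ)
    (hE : E.Integrates δ) {i : ℕ} (hi : i ≤ 1) (him : i ≤ m) (hin : i ≤ n) :
    D.coeff (idx i) = E.coeff (idx i) := by
  rcases Nat.le_one_iff_eq_zero_or_eq_one.1 hi with rfl | rfl
  · rw [idx_zero, D.coeff_zero, E.coeff_zero]
  · rw [hD him, hE hin]

theorem opT_idx_mem {Δ : Coideal 1} (D : HS k A Δ) (n : ℕ) : opT D (idx n) ∈ (filU k A).F n := by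
  have := opT_mem_degree D (idx n)
  rwa [Finsupp.degree_single] at this

theorem HS.Integrates.opT_sub_mem {m n i : ℕ} {D : HS k A (Coideal.tot 1 m)}
    {E : HS k A (Coideal.tot 1 n)} {δ : Derivation k A A} (hD : D.Integrates δ)
    (hE : E.Integrates δ) (him : i ≤ m) (hin : i ≤ n) :
    opT D (idx i) - opT E (idx i) ∈ (filU k A).lt i := by
  have h1 : ∀ e ∈ Coideal.tot 1 i, e ∈ Coideal.tot 1 m := fun e he => le_trans (b := i) he him
  have h2 : ∀ e ∈ Coideal.tot 1 i, e ∈ Coideal.tot 1 n := fun e he => le_trans (b := i) he hin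
  have hi := idx_mem_tot (le_refl i)
  rw [← opT_trunc D h1 hi, ← opT_trunc E h2 hi]
  have := opT_sub_mem_of_agree (D.trunc _ h1) (E.trunc _ h2) hi fun β hβ hdeg => by
    have hle : β.degree ≤ i := (Finsupp.degree_mono hβ).trans (Finsupp.degree_single _ _).le
    rw [D.trunc_coeff h1 (Coideal.mem_of_le _ hβ hi),
      E.trunc_coeff h2 (Coideal.mem_of_le _ hβ hi), eq_idx β]
    exact hD.coeff_eq hE hdeg (hle.trans him) (hle.trans hin)
  rwa [Finsupp.degree_single] at this

theorem exists_integral (δ : IderF k A) (m : ℕ) :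
    ∃ D : HS k A (Coideal.tot 1 m), D.Integrates (δ : Derivation k A A) := by
  by_cases hm : 1 ≤ m
  · obtain ⟨D, hD⟩ := (Submodule.mem_iInf _).1 ((Submodule.mem_iInf _).1 δ.2 m) hm
    exact ⟨D, fun _ => hD⟩
  · exact ⟨HS.one _, fun h => absurd h hm⟩

/-- The symbol of `𝐓_{1,n,D,n}` for any `n`-integral `D` of `δ`. -/
def gammaGr (n : ℕ) (δ : IderF k A) : GrU k A :=
  (filU k A).symbol n _ (opT_idx_mem (exists_integral δ n).choose n)

theorem HS.Integrates.hasSymbol {δ : IderF k A} {m n : ℕ} {D : HS k A (Coideal.tot 1 m)}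
    (hD : D.Integrates (δ : Derivation k A A)) (hn : n ≤ m) :
    (filU k A).HasSymbol n (opT D (idx n)) (gammaGr n δ) :=
  .of_sub_mem ⟨_, rfl⟩ (opT_idx_mem D n)
    (hD.opT_sub_mem (exists_integral δ n).choose_spec hn le_rfl)

theorem hasSymbol_symT {m : ℕ} (D : HS k A (Coideal.tot 1 m)) :
    (filU k A).HasSymbol m (opT D (idx m)) (symT D) := by
  rw [opT_of_mem D (idx_mem_tot le_rfl)]
  exact ⟨_, rfl⟩

theorem HS.Integrates.symT_eq {δ : IderF k A} {m : ℕ} {D : HS k A (Coideal.tot 1 m)}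
    (hD : D.Integrates (δ : Derivation k A A)) : symT D = gammaGr m δ :=
  (hasSymbol_symT D).unique (hD.hasSymbol le_rfl)

/-! ### The relations of divided powers -/

theorem gammaGr_zero (δ : IderF k A) : gammaGr 0 δ = 1 := by
  obtain ⟨D, hD⟩ := exists_integral δ 0
  refine (hD.hasSymbol le_rfl).unique ?_
  rw [idx_zero, opT_zero]
  exact ⟨_, (filU k A).symbol_one⟩

theorem gammaGr_smul (n : ℕ) (a : A) (δ : IderF k A) :
    gammaGr n (a • δ) = symSHom k A (a ^ n) * gammaGr n δ := by
  obtain ⟨D, hD⟩ := exists_integral δ n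
  set φ : SubstMap A (Coideal.tot 1 n) (Coideal.tot 1 n) :=
    monomialSubst (AddMonoidHom.id _) a (fun _ => le_rfl) (fun _ h => h)
  have hE : (D.bullet φ).Integrates ((a • δ : IderF k A) : Derivation k A A) := fun hn => by
    refine (bullet_monomialSubst_coeff (AddMonoidHom.id _) a (fun _ => le_rfl) (fun _ h => h) D
      Function.injective_id (α := idx 1) (idx_mem_tot hn)).trans ?_
    rw [Finsupp.degree_single, pow_one, hD hn]
    rfl
  refine (hE.hasSymbol le_rfl).unique ?_
  have h := opT_bullet_monomialSubst (AddMonoidHom.id _) a (fun _ => le_rfl) (fun _ h => h) D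
      Function.injective_id (α := idx n) (idx_mem_tot (le_refl n))
  rw [Finsupp.degree_single] at h
  have h' := (hasSymbol_symS (k := k) (a ^ n)).mul (hD.hasSymbol le_rfl)
  rw [zero_add] at h'
  exact h ▸ h'

theorem gammaGr_add (n : ℕ) (δ ε : IderF k A) :
    gammaGr n (δ + ε) = ∑ x ∈ antidiagonal n, gammaGr x.1 δ * gammaGr x.2 ε := by
  obtain ⟨D, hD⟩ := exists_integral δ n
  obtain ⟨E, hE⟩ := exists_integral ε n
  have hanti : ∀ {M : Type (max u v)} [AddCommMonoid M]
      (f : (Fin 1 →₀ ℕ) × (Fin 1 →₀ ℕ) → M) (n : ℕ),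
      ∑ x ∈ antidiagonal (idx n), f x = ∑ x ∈ antidiagonal n, f (idx x.1, idx x.2) := by
    intro M _ f n
    rw [Finsupp.antidiagonal_single, Finset.sum_map]
    rfl
  have hDE : (D.comp E).Integrates ((δ + ε : IderF k A) : Derivation k A A) := fun hn => by
    ext x
    have h : antidiagonal (idx 1) = {(0, idx 1), (idx 1, 0)} := by
      rw [Finsupp.antidiagonal_single]
      simp [Finset.Nat.antidiagonal_succ]
    rw [HS.comp_coeff _ _ (idx_mem_tot hn), h, Finset.sum_pair (by simp), D.coeff_zero,
      E.coeff_zero, hD hn, hE hn]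
    exact add_comm _ _
  refine (hDE.hasSymbol le_rfl).unique ?_
  rw [opT_comp _ _ (idx_mem_tot le_rfl), hanti]
  refine .sum fun x hx => ?_
  have hx' := mem_antidiagonal.1 hx
  have h := (hD.hasSymbol (n := x.1) (by omega)).mul (hE.hasSymbol (n := x.2) (by omega))
  rwa [hx'] at h

/-- The power series `s + t` in two variables. -/
def sumXY (A : Type v) [CommRing A] : MvPowerSeries (Fin (1 + 1)) A :=
  MvPowerSeries.monomial (pairEquiv 1 1 (idx 1, 0)) 1 +
    MvPowerSeries.monomial (pairEquiv 1 1 (0, idx 1)) 1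

theorem coeff_sumXY_pow (n i j : ℕ) :
    MvPowerSeries.coeff (pairEquiv 1 1 (idx i, idx j)) (sumXY A ^ n) =
      if i + j = n then (n.choose i : A) else 0 := by
  classical
  have h1 : ∀ x : ℕ × ℕ,
      MvPowerSeries.monomial (pairEquiv 1 1 (idx 1, 0)) (1 : A) ^ x.1 *
        MvPowerSeries.monomial (pairEquiv 1 1 (0, idx 1)) (1 : A) ^ x.2 =
      MvPowerSeries.monomial (pairEquiv 1 1 (idx x.1, idx x.2)) (1 : A) := by
    intro x
    rw [MvPowerSeries.monomial_pow, MvPowerSeries.monomial_pow,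
      MvPowerSeries.monomial_mul_monomial, one_pow, one_pow, one_mul, ← map_nsmul, ← map_nsmul,
      ← map_add]
    congr 3
    ext1 <;> simp
  have h2 : ∀ x : ℕ × ℕ, pairEquiv 1 1 (idx i, idx j) = pairEquiv 1 1 (idx x.1, idx x.2) ↔
      x = (i, j) := by
    intro x
    rw [(pairEquiv 1 1).injective.eq_iff, Prod.ext_iff, Prod.ext_iff,
      (Finsupp.single_injective _).eq_iff, (Finsupp.single_injective _).eq_iff]
    exact ⟨fun h => ⟨h.1.symm, h.2.symm⟩, fun h => ⟨h.1.symm, h.2.symm⟩⟩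
  rw [sumXY, (Commute.all _ _).add_pow', map_sum]
  simp_rw [h1, map_nsmul, MvPowerSeries.coeff_monomial, h2, smul_ite, smul_zero]
  rw [Finset.sum_ite_eq']
  simp only [mem_antidiagonal, nsmul_eq_mul, mul_one]

/-- The substitution map `s ↦ s + t`. -/
def addSubst (A : Type v) [CommRing A] (m n : ℕ) :
    SubstMap A (Coideal.tot 1 (m + n)) ((Coideal.tot 1 m).prod (Coideal.tot 1 n)) :=
  SubstMap.ofCoeff (fun e α => MvPowerSeries.coeff e (sumXY A ^ α.degree))
    (fun e α h => by
      obtain ⟨⟨b, c⟩, rfl⟩ := (pairEquiv 1 1).surjective e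
      rw [degree_pairEquiv] at h
      rw [eq_idx b, eq_idx c, coeff_sumXY_pow, if_neg (by simp only at h; omega)])
    (fun e he α hα => by
      obtain ⟨⟨b, c⟩, rfl⟩ := (pairEquiv 1 1).surjective e
      obtain ⟨hb, hc⟩ := Coideal.pair_mem_prod.1 he
      have hb' : b.degree ≤ m := hb
      have hc' : c.degree ≤ n := hc
      have hα' : ¬ α.degree ≤ m + n := hα
      rw [eq_idx b, eq_idx c, coeff_sumXY_pow, if_neg (by omega)])
    (fun e => by rw [map_zero, pow_zero, MvPowerSeries.coeff_one])
    (fun e _ α α' => by rw [map_add, pow_add, MvPowerSeries.coeff_mul])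

theorem C_addSubst {m n i j : ℕ} (hi : i ≤ m) (hj : j ≤ n) {α : Fin 1 →₀ ℕ}
    (hα : α ∈ Coideal.tot 1 (m + n)) :
    (addSubst A m n).C (pairEquiv 1 1 (idx i, idx j)) α =
      if α = idx (i + j) then ((i + j).choose i : A) else 0 := by
  rw [addSubst, SubstMap.C_ofCoeff _ _ _ _ _
    (Coideal.pair_mem_prod.2 ⟨idx_mem_tot hi, idx_mem_tot hj⟩) hα, coeff_sumXY_pow]
  by_cases h : i + j = α.degree
  · rw [if_pos h, if_pos (by rw [h]; exact eq_idx α), h]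
  · rw [if_neg h, if_neg fun h' => h (by rw [h', Finsupp.degree_single])]

theorem idx_mem_upTo {m n i j : ℕ} (hi : i ≤ m) (hj : j ≤ n) :
    idx (i + j) ∈ (Coideal.tot 1 (m + n)).upTo (pairEquiv 1 1 (idx i, idx j)).degree := by
  refine Coideal.mem_upTo.2 ⟨?_, idx_mem_tot (by omega)⟩
  rw [degree_pairEquiv, Finsupp.degree_single, Finsupp.degree_single, Finsupp.degree_single]

theorem bullet_addSubst_coeff {m n i j : ℕ} (D : HS k A (Coideal.tot 1 (m + n))) (hi : i ≤ m)
    (hj : j ≤ n) : (D.bullet (addSubst A m n)).coeff (pairEquiv 1 1 (idx i, idx j)) =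
      ((i + j).choose i : A) • D.coeff (idx (i + j)) := by
  rw [bullet_coeff, Finset.sum_eq_single (idx (i + j))]
  · rw [C_addSubst hi hj (idx_mem_tot (by omega)), if_pos rfl]
  · intro β hβ hne
    rw [C_addSubst hi hj (Coideal.mem_upTo.1 hβ).2, if_neg hne, zero_smul]
  · intro h
    exact absurd (idx_mem_upTo hi hj) h

theorem opT_bullet_addSubst {m n i j : ℕ} (D : HS k A (Coideal.tot 1 (m + n))) (hi : i ≤ m)
    (hj : j ≤ n) : opT (D.bullet (addSubst A m n)) (pairEquiv 1 1 (idx i, idx j)) =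
      opS k ((i + j).choose i : A) * opT D (idx (i + j)) := by
  rw [opT_bullet _ _ (Coideal.pair_mem_prod.2 ⟨idx_mem_tot hi, idx_mem_tot hj⟩),
    Finset.sum_eq_single (idx (i + j))]
  · rw [C_addSubst hi hj (idx_mem_tot (by omega)), if_pos rfl]
  · intro β hβ hne
    rw [C_addSubst hi hj (Coideal.mem_upTo.1 hβ).2, if_neg hne, map_zero, zero_mul]
  · intro h
    exact absurd (idx_mem_upTo hi hj) h

/-- `γ_m(δ) γ_n(δ) = (m+n choose m) γ_{m+n}(δ)`: for an integral `D` of `δ`, the external product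
of `D` with itself and the image of `D` under `s ↦ s + t` agree up to order one. -/
theorem gammaGr_mul (m n : ℕ) (δ : IderF k A) :
    gammaGr m δ * gammaGr n δ = (m + n).choose m • gammaGr (m + n) δ := by
  obtain ⟨D, hD⟩ := exists_integral δ (m + n)
  obtain ⟨D₁, hD₁⟩ := exists_integral δ m
  obtain ⟨D₂, hD₂⟩ := exists_integral δ n
  set G := D.bullet (addSubst A m n)
  set H := (D₁.inl (Coideal.tot 1 n)).comp (D₂.inr (Coideal.tot 1 m))
  have hm := idx_mem_tot (le_refl m)
  have hn := idx_mem_tot (le_refl n)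
  have hdeg : (pairEquiv 1 1 (idx m, idx n)).degree = m + n := by
    rw [degree_pairEquiv, Finsupp.degree_single, Finsupp.degree_single]
  have hsub := opT_sub_mem_of_agree G H (Coideal.pair_mem_prod.2 ⟨hm, hn⟩) fun β hβ hβ1 => by
    obtain ⟨⟨b, c⟩, rfl⟩ := (pairEquiv 1 1).surjective β
    obtain ⟨hb, hc⟩ : b ≤ idx m ∧ c ≤ idx n := pairEquiv_le.1 hβ
    have hb' := Finsupp.degree_mono hb
    have hc' := Finsupp.degree_mono hc
    rw [Finsupp.degree_single] at hb' hc'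
    rw [degree_pairEquiv] at hβ1
    simp only at hβ1
    rw [HS.inl_comp_inr_coeff _ _ (Coideal.mem_of_le _ hb hm) (Coideal.mem_of_le _ hc hn),
      eq_idx b, eq_idx c, bullet_addSubst_coeff D hb' hc']
    generalize b.degree = i at hb' hβ1
    generalize c.degree = j at hc' hβ1
    rw [hD₁.coeff_eq hD (i := i) (by omega) hb' (by omega),
      hD₂.coeff_eq hD (i := j) (by omega) hc' (by omega)]
    obtain ⟨rfl, rfl⟩ | ⟨rfl, rfl⟩ | ⟨rfl, rfl⟩ :
      (i = 0 ∧ j = 0) ∨ (i = 1 ∧ j = 0) ∨ (i = 0 ∧ j = 1) := by omega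
    · simp [D.coeff_zero]
    · simp [D.coeff_zero]
    · simp [D.coeff_zero]
  rw [hdeg] at hsub
  have hH := (hD₁.hasSymbol le_rfl).mul (hD₂.hasSymbol le_rfl)
  rw [← opT_inl_comp_inr D₁ D₂ hm hn] at hH
  have hG := (hasSymbol_symS (k := k) ((m + n).choose m : A)).mul (hD.hasSymbol le_rfl)
  rw [← opT_bullet_addSubst D le_rfl le_rfl, zero_add] at hG
  obtain ⟨hGmem, -⟩ := id hG
  rw [(hH.of_sub_mem hGmem hsub).unique hG, nsmul_eq_mul]
  congr 1
  exact map_natCast (symSHom k A) _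

/-! ### Existence and uniqueness -/

variable (k A) in
/-- The canonical homomorphism `Γ_A Ider^f_k(A) → gr 𝕌_{A/k}`. -/
def theta : DividedPowerAlgebra A (IderF k A) →+* GrU k A :=
  letI := grUCommRing k A
  letI := (symSHom k A).toAlgebra
  (DividedPowerAlgebra.lift' (f := fun x : ℕ × IderF k A => gammaGr x.1 x.2) gammaGr_zero
    gammaGr_smul gammaGr_mul gammaGr_add).toRingHom

theorem isTheta_theta : IsTheta (theta k A) where
  map_algebraMap a := by
    let := grUCommRing k A
    let := (symSHom k A).toAlgebra
    exact AlgHom.commutes (DividedPowerAlgebra.lift' (f := fun x : ℕ × IderF k A =>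
      gammaGr x.1 x.2) gammaGr_zero gammaGr_smul gammaGr_mul gammaGr_add) a
  map_dp δ m _ D hD := by
    let := grUCommRing k A
    let := (symSHom k A).toAlgebra
    rw [HS.Integrates.symT_eq (δ := δ) fun _ => hD]
    exact DividedPowerAlgebra.lift'_apply_dp gammaGr_zero gammaGr_smul gammaGr_mul gammaGr_add m δ

theorem IsTheta.map_dp_eq {ϑ : DividedPowerAlgebra A (IderF k A) →+* GrU k A} (h : IsTheta ϑ)
    (n : ℕ) (δ : IderF k A) : ϑ (DividedPowerAlgebra.dp A n δ) = gammaGr n δ := by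
  rcases Nat.eq_zero_or_pos n with rfl | hn
  · rw [DividedPowerAlgebra.dp_zero, map_one, gammaGr_zero]
  · obtain ⟨D, hD⟩ := exists_integral δ n
    rw [h.map_dp δ n hn D (hD hn), hD.symT_eq]

theorem IsTheta.unique {ϑ ϑ' : DividedPowerAlgebra A (IderF k A) →+* GrU k A} (h : IsTheta ϑ)
    (h' : IsTheta ϑ') : ϑ = ϑ' := by
  refine RingHom.ext fun x => ?_
  induction x using DividedPowerAlgebra.induction_on with
  | C a => rw [h.map_algebraMap, h'.map_algebraMap]
  | add x y hx hy => rw [map_add, map_add, hx, hy]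
  | dp x n δ hx => rw [map_mul, map_mul, hx, h.map_dp_eq, h'.map_dp_eq]

/-! ### Surjectivity -/

/-- The symbol of `x` in degree `n` is defined and lies in the subring `B`. -/
def SymbolMem (B : Subring (GrU k A)) (n : ℕ) (x : U k A) : Prop :=
  ∃ g ∈ B, (filU k A).HasSymbol n x g

namespace SymbolMem

variable {B : Subring (GrU k A)} {n m : ℕ} {x y : U k A}

theorem zero : SymbolMem B n (0 : U k A) :=
  ⟨0, zero_mem B, .of_mem_lt (zero_mem _) (zero_mem _)⟩

theorem one : SymbolMem B 0 (1 : U k A) :=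
  ⟨1, one_mem B, _, (filU k A).symbol_one⟩

theorem add (hx : SymbolMem B n x) (hy : SymbolMem B n y) : SymbolMem B n (x + y) := by
  obtain ⟨g, hg, hx⟩ := hx
  obtain ⟨h, hh, hy⟩ := hy
  exact ⟨g + h, add_mem hg hh, hx.add hy⟩

theorem mul (hx : SymbolMem B n x) (hy : SymbolMem B m y) : SymbolMem B (n + m) (x * y) := by
  obtain ⟨g, hg, hx⟩ := hx
  obtain ⟨h, hh, hy⟩ := hy
  exact ⟨g * h, mul_mem hg hh, hx.mul hy⟩

/-- In a degree larger than necessary the symbol is zero. -/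
theorem mono (hx : SymbolMem B n x) (h : n ≤ m) : SymbolMem B m x := by
  rcases h.eq_or_lt with rfl | h
  · exact hx
  · obtain ⟨_, _, hx, _⟩ := hx
    exact ⟨0, zero_mem B, .of_mem_lt ((filU k A).mem_lt hx h) ((filU k A).mono h.le hx)⟩

theorem sum {ι : Type*} {s : Finset ι} {f : ι → U k A} (h : ∀ i ∈ s, SymbolMem B n (f i)) :
    SymbolMem B n (∑ i ∈ s, f i) :=
  Finset.sum_induction _ _ (fun _ _ => add) zero h

end SymbolMem

/-- The additive map `n ↦ n β`. -/
def multHom (β : Fin p →₀ ℕ) : (Fin 1 →₀ ℕ) →+ (Fin p →₀ ℕ) where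
  toFun n := n.degree • β
  map_zero' := by rw [map_zero, zero_smul]
  map_add' m n := by rw [map_add, add_smul]

theorem degree_multHom (β : Fin p →₀ ℕ) (n : Fin 1 →₀ ℕ) :
    (multHom β n).degree = n.degree * β.degree := by
  change (n.degree • β).degree = _
  rw [map_nsmul, smul_eq_mul]

theorem degree_le_degree_multHom {β : Fin p →₀ ℕ} (hβ : β ≠ 0) (n : Fin 1 →₀ ℕ) :
    n.degree ≤ (multHom β n).degree := by
  rw [degree_multHom]
  exact Nat.le_mul_of_pos_right _ (degree_pos hβ)

theorem multHom_injective {β : Fin p →₀ ℕ} (hβ : β ≠ 0) : Function.Injective (multHom β) := by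
  intro m n h
  have h' := congrArg Finsupp.degree h
  rw [degree_multHom, degree_multHom] at h'
  rw [eq_idx m, eq_idx n, Nat.eq_of_mul_eq_mul_right (degree_pos hβ) h']

theorem mem_tot_of_multHom_mem {α β : Fin p →₀ ℕ} (hβ : β ≠ 0) (n : Fin 1 →₀ ℕ)
    (h : multHom β n ∈ Coideal.below α) : n ∈ Coideal.tot 1 α.degree :=
  (degree_le_degree_multHom hβ n).trans (Finsupp.degree_mono (Coideal.mem_below.1 h))

/-- The image of a Hasse--Schmidt derivation in one variable under `s ↦ s^β`. -/
def HS.onPowers {α β : Fin p →₀ ℕ} (hβ : β ≠ 0) (E : HS k A (Coideal.tot 1 α.degree)) :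
    HS k A (Coideal.below α) :=
  E.bullet (monomialSubst (multHom β) 1 (degree_le_degree_multHom hβ) (mem_tot_of_multHom_mem hβ))

section OnPowers

variable {α β : Fin p →₀ ℕ} (hβ : β ≠ 0) (E : HS k A (Coideal.tot 1 α.degree))

theorem HS.onPowers_coeff_self (hβα : β ≤ α) : (E.onPowers hβ).coeff β = E.coeff (idx 1) := by
  have h1 : multHom β (idx 1) = β := by
    change (idx 1).degree • β = β
    rw [Finsupp.degree_single, one_smul]
  have := bullet_monomialSubst_coeff (multHom β) (1 : A) (degree_le_degree_multHom hβ)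
    (mem_tot_of_multHom_mem hβ) E (multHom_injective hβ) (α := idx 1)
    (Coideal.mem_below.2 (h1.symm ▸ hβα))
  rwa [one_pow, one_smul, h1] at this

theorem HS.onPowers_coeff_eq_zero {γ : Fin p →₀ ℕ} (h0 : γ ≠ 0) (hne : γ ≠ β)
    (hdeg : γ.degree ≤ β.degree) : (E.onPowers hβ).coeff γ = 0 := by
  refine bullet_monomialSubst_coeff_eq_zero _ _ _ _ _ fun n hn => ?_
  have hd := congrArg Finsupp.degree hn
  rw [degree_multHom] at hd
  have hn0 : n.degree ≠ 0 := fun h => h0 (by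
    rw [hn, (Finsupp.degree_eq_zero_iff n).1 h, map_zero])
  have hn1 : n.degree ≠ 1 := fun h => hne (by
    rw [hn]
    change n.degree • β = β
    rw [h, one_smul])
  have h2 : 2 * β.degree ≤ n.degree * β.degree := Nat.mul_le_mul_right _ (by omega)
  have := degree_pos hβ
  omega

/-- The operators of `E.onPowers` are those of `E` at the multiples of `β`, and zero elsewhere. -/
theorem opT_onPowers {γ : Fin p →₀ ℕ} (hγ : γ ≤ α) : opT (E.onPowers hβ) γ = 0 ∨
    ∃ n ≤ α.degree, γ.degree = n * β.degree ∧ opT (E.onPowers hβ) γ = opT E (idx n) := by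
  by_cases h : ∃ n, γ = multHom β n
  · obtain ⟨n, rfl⟩ := h
    refine Or.inr ⟨n.degree, mem_tot_of_multHom_mem hβ n (Coideal.mem_below.2 hγ),
      degree_multHom _ _, ?_⟩
    have := opT_bullet_monomialSubst (multHom β) (1 : A) (degree_le_degree_multHom hβ)
      (mem_tot_of_multHom_mem hβ) E (multHom_injective hβ) (Coideal.mem_below.2 hγ)
    rw [one_pow, map_one, one_mul] at this
    rw [← eq_idx n]
    exact this
  · push Not at h
    exact Or.inl (opT_bullet_monomialSubst_eq_zero _ _ _ _ _ h)

end OnPowers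

/-- A component of a Hasse--Schmidt derivation below which all the others vanish is a
derivation. -/
def HS.leadingDerivation {Δ : Coideal p} (D : HS k A Δ) {β : Fin p →₀ ℕ} (hβ : β ∈ Δ)
    (h0 : β ≠ 0) (h : D.VanishBelow β β.degree) : Derivation k A A :=
  Derivation.mk' (D.coeff β) fun x y => by
    have hsub : ({(0, β), (β, 0)} : Finset _) ⊆ antidiagonal β := by
      intro x hx
      rcases Finset.mem_insert.1 hx with rfl | hx
      · simp
      · rw [Finset.mem_singleton.1 hx]; simp
    rw [D.leibniz β hβ, ← Finset.sum_subset hsub, Finset.sum_pair (by simp [Ne.symm h0]),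
      D.coeff_zero]
    · simp [mul_comm]
    · intro z hz hz'
      have hze := mem_antidiagonal.1 hz
      have h1 : z.1 ≠ 0 := fun h1 => hz' (by
        rw [h1, zero_add] at hze
        simp [Prod.ext_iff, h1, hze])
      have h2 : z ≠ (β, 0) := fun h2 => hz' (by simp [h2])
      rw [h z.1 (hze ▸ le_self_add) h1 (degree_lt_of_ne hz h2), LinearMap.zero_apply, zero_mul]

/-- The operators `𝐓_{D,γ}` have symbol in `B`, for `D` vanishing below `r`. If `D` has a non-zero
component `D_β` with `|β| = r`, then `D_β` is an integrable derivation, and `D = F ∘ P` where `P`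
is the image of an integral of `D_β` under `s ↦ s^β` and `F` has fewer non-zero components in
degree `r`; if there is none then `D` vanishes below `r + 1`. -/
theorem symbolMem_opT_below {B : Subring (GrU k A)} (hI : IderF k A = ⊤)
    (hB : ∀ (n : ℕ) (δ : IderF k A), gammaGr n δ ∈ B)
    {α : Fin p →₀ ℕ} {l : ℕ} (hl : 1 ≤ l) (s : ℕ) :
    ∀ r, l ≤ r → α.degree < r + s → ∀ D : HS k A (Coideal.below α), D.VanishBelow α r →
      ∀ γ ≤ α, SymbolMem B (γ.degree / l) (opT D γ) := by
  classical
  induction s with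
  | zero =>
    intro r _ hr D hD γ hγ
    by_cases h0 : γ = 0
    · rw [h0, opT_zero]
      exact SymbolMem.one.mono (Nat.zero_le _)
    · rw [opT_eq_zero D h0 fun β hβ hβ0 =>
        hD β (hβ.trans hγ) hβ0 ((Finsupp.degree_mono (hβ.trans hγ)).trans_lt hr)]
      exact SymbolMem.zero
  | succ s ih =>
    intro r hlr hr D hD
    set S : HS k A (Coideal.below α) → Finset (Fin p →₀ ℕ) := fun D =>
      ((Coideal.below α).upTo r).filter fun β => β.degree = r ∧ D.coeff β ≠ 0 with hS
    have hmemS : ∀ D β, β ∈ S D ↔ β ≤ α ∧ β.degree = r ∧ D.coeff β ≠ 0 := by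
      intro D β
      rw [hS, Finset.mem_filter, Coideal.mem_upTo, Coideal.mem_below]
      exact ⟨fun h => ⟨h.1.2, h.2⟩, fun h => ⟨⟨h.2.1.le, h.1⟩, h.2⟩⟩
    induction hc : (S D).card using Nat.strong_induction_on generalizing D with
    | _ c ihc =>
      rcases (S D).eq_empty_or_nonempty with hemp | ⟨β, hβS⟩
      · refine ih (r + 1) (by omega) (by omega) D fun β hβ h0 hlt => ?_
        rcases (Nat.lt_succ_iff.1 hlt).lt_or_eq with h | h
        · exact hD β hβ h0 h
        · by_contra hne
          have : β ∈ S D := (hmemS D β).2 ⟨hβ, h, hne⟩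
          rw [hemp] at this
          exact Finset.notMem_empty _ this
      · obtain ⟨hβα, hβr, hβD⟩ := (hmemS D β).1 hβS
        have hβ0 : β ≠ 0 := by
          rintro rfl
          rw [map_zero] at hβr
          omega
        set δ := D.leadingDerivation (Coideal.mem_below.2 hβα) hβ0 (by
          rw [hβr]
          exact hD.mono hβα) with hδ
        have hδI : δ ∈ IderF k A := hI ▸ Submodule.mem_top
        obtain ⟨E, hE⟩ := exists_integral ⟨δ, hδI⟩ α.degree
        have hα1 : 1 ≤ α.degree := (degree_pos hβ0).trans_le (Finsupp.degree_mono hβα)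
        set P := E.onPowers hβ0 with hP
        have hagree : ∀ γ ≤ α, γ.degree ≤ r → (γ.degree = r → γ = β ∨ D.coeff γ = 0) →
            D.coeff γ = P.coeff γ := by
          intro γ hγ hdeg hr
          by_cases hγ0 : γ = 0
          · rw [hγ0, D.coeff_zero, P.coeff_zero]
          by_cases hγβ : γ = β
          · rw [hγβ, hP, HS.onPowers_coeff_self hβ0 E hβα, hE hα1]
            rfl
          · rw [hP, HS.onPowers_coeff_eq_zero hβ0 E hγ0 hγβ (hdeg.trans hβr.ge)]
            rcases hdeg.lt_or_eq with h | h
            · exact hD γ hγ hγ0 h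
            · exact (hr h).resolve_left hγβ
        have hFzero : ∀ γ ≤ α, γ ≠ 0 → γ.degree ≤ r →
            (γ.degree = r → γ = β ∨ D.coeff γ = 0) → (D.div P).coeff γ = 0 := by
          intro γ hγ hγ0 hdeg hr
          refine HS.div_coeff_eq_zero D P (Coideal.mem_below.2 hγ) hγ0 fun ε hε => ?_
          have hmono := Finsupp.degree_mono hε
          refine hagree ε (hε.trans hγ) (hmono.trans hdeg) fun hεr => ?_
          obtain ⟨d, rfl⟩ := exists_add_of_le hε
          rw [map_add] at hdeg
          have hd : d = 0 := (Finsupp.degree_eq_zero_iff d).1 (by omega)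
          rw [hd, add_zero] at hr
          exact hr hεr
        have hF : (D.div P).VanishBelow α r := fun γ hγ hγ0 hlt =>
          hFzero γ hγ hγ0 hlt.le fun h => absurd h hlt.ne
        have hlt : (S (D.div P)).card < c := by
          rw [← hc]
          refine Finset.card_lt_card (Finset.ssubset_iff_subset_ne.2 ⟨fun γ hγ => ?_, fun h => ?_⟩)
          · obtain ⟨h1, h2, h3⟩ := (hmemS _ γ).1 hγ
            refine (hmemS D γ).2 ⟨h1, h2, fun h => h3 ?_⟩
            refine hFzero γ h1 ?_ h2.le fun _ => Or.inr h
            rintro rfl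
            rw [map_zero] at h2
            omega
          · rw [← h] at hβS
            exact ((hmemS _ β).1 hβS).2.2 (hFzero β hβα hβ0 hβr.le fun _ => Or.inl rfl)
        intro γ hγ
        have hDF : opT D γ = opT ((D.div P).comp P) γ := by rw [HS.div_comp]
        rw [hDF, opT_comp _ _ (Coideal.mem_below.2 hγ)]
        refine SymbolMem.sum fun x hx => ?_
        have hx' := mem_antidiagonal.1 hx
        have hx1 : x.1 ≤ α := (hx' ▸ le_self_add : x.1 ≤ γ).trans hγ
        have hx2 : x.2 ≤ α := (hx' ▸ le_add_self : x.2 ≤ γ).trans hγ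
        have h1 := ihc _ hlt (D.div P) hF rfl x.1 hx1
        have h2 : SymbolMem B (x.2.degree / l) (opT P x.2) := by
          rcases opT_onPowers hβ0 E hx2 with h | ⟨n, hn, hdeg, h⟩
          · rw [hP, h]
            exact SymbolMem.zero
          · rw [hP, h]
            refine SymbolMem.mono ⟨_, hB n ⟨δ, hδI⟩, hE.hasSymbol hn⟩ ?_
            rw [hdeg, Nat.le_div_iff_mul_le hl]
            exact Nat.mul_le_mul_left n (by omega)
        refine (h1.mul h2).mono ?_
        rw [← hx', map_add]
        exact Nat.div_add_div_le_add_div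

theorem symbolMem_opT {B : Subring (GrU k A)} (hI : IderF k A = ⊤)
    (hB : ∀ (n : ℕ) (δ : IderF k A), gammaGr n δ ∈ B)
    {Δ : Coideal p} (D : HS k A Δ) {α : Fin p →₀ ℕ} (hα : α ∈ Δ) {l : ℕ}
    (hl : 1 ≤ l) (h : D.VanishBelow α l) : SymbolMem B (α.degree / l) (opT D α) := by
  have hle : ∀ e ∈ Coideal.below α, e ∈ Δ := fun e he => Δ.mem_of_le (Coideal.mem_below.1 he) hα
  rw [← opT_trunc D hle (Coideal.mem_below.2 le_rfl)]
  refine symbolMem_opT_below hI hB hl (α.degree + 1) l le_rfl (by omega) _ ?_ α le_rfl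
  intro β hβ h0 hlt
  rw [D.trunc_coeff hle (Coideal.mem_below.2 hβ), h β hβ h0 hlt]

theorem symbolMem_gen {B : Subring (GrU k A)} (hI : IderF k A = ⊤)
    (hB : ∀ (n : ℕ) (δ : IderF k A), gammaGr n δ ∈ B)
    (hS : ∀ a : A, symS k a ∈ B) (x : Gen k A) :
    SymbolMem B x.deg (toU k A (FreeAlgebra.ι k x)) := by
  rcases x with a | ⟨p, Δ, D, α, hα⟩
  · exact ⟨_, hS a, hasSymbol_symS a⟩
  · change SymbolMem B _ (toU k A (varT D α hα))
    rw [← opT_of_mem]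
    rcases Gen.deg_T_cases D hα with (h | h) | ⟨l, hl, hD, hdeg⟩
    · rw [h]
      exact SymbolMem.zero
    · rw [h]
      exact SymbolMem.one.mono (Nat.zero_le _)
    · rw [hdeg]
      exact symbolMem_opT hI hB D hα hl hD

theorem symbolMem_of_mem {B : Subring (GrU k A)} (hI : IderF k A = ⊤)
    (hB : ∀ (n : ℕ) (δ : IderF k A), gammaGr n δ ∈ B)
    (hS : ∀ a : A, symS k a ∈ B) {d : ℕ} {x : U k A}
    (hx : x ∈ (filU k A).F d) : SymbolMem B d x := by
  refine mem_filU_induction (P := SymbolMem B d) (fun l hl => ?_) SymbolMem.zero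
    (fun _ _ => SymbolMem.add) (fun c x hx => ?_) hx
  · refine SymbolMem.mono ?_ hl
    clear hl
    induction l with
    | nil =>
      simp only [List.map_nil, List.prod_nil, List.sum_nil, map_one]
      exact SymbolMem.one
    | cons y l ih =>
      simp only [List.map_cons, List.prod_cons, map_mul, List.sum_cons]
      exact (symbolMem_gen hI hB hS y).mul ih
  · rw [Algebra.smul_def, ← opS_algebraMap]
    exact (SymbolMem.mul ⟨_, hS _, hasSymbol_symS _⟩ hx).mono (zero_add d).le

theorem IsTheta.surjective {ϑ : DividedPowerAlgebra A (IderF k A) →+* GrU k A} (h : IsTheta ϑ)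
    (hI : IderF k A = ⊤) : Function.Surjective ϑ := by
  have hB : ∀ (n : ℕ) (δ : IderF k A), gammaGr n δ ∈ ϑ.range := fun n δ => ⟨_, h.map_dp_eq n δ⟩
  have hS : ∀ a : A, symS k a ∈ ϑ.range := fun a => ⟨_, h.map_algebraMap a⟩
  refine (filU k A).gr_induction (P := fun y => y ∈ ϑ.range) (zero_mem _)
    (fun x y => add_mem) fun i x hx => ?_
  obtain ⟨g, hg, hxg⟩ := symbolMem_of_mem hI hB hS hx
  obtain ⟨_, rfl⟩ := hxg
  exact hg

end HSEnv
end

theorem mainTheorem6 {k : Type*} {A : Type*} [CommRing k] [CommRing A] [Algebra k A] :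
    (∃! ϑ : DividedPowerAlgebra A (HSEnv.IderF k A) →+* HSEnv.GrU k A, HSEnv.IsTheta ϑ) ∧
      (HSEnv.IderF k A = ⊤ →
        ∀ ϑ : DividedPowerAlgebra A (HSEnv.IderF k A) →+* HSEnv.GrU k A,
          HSEnv.IsTheta ϑ → Function.Surjective ϑ) :=
  ⟨⟨HSEnv.theta k A, HSEnv.isTheta_theta, fun _ h => h.unique HSEnv.isTheta_theta⟩,
    fun hI _ h => h.surjective hI⟩
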